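/- Let $K$ be a CM field with complex conjugation $b\mapsto\bar b$, let $\Sigma$ be a CM type of $K$, and let $V$ be a finite-dimensional $K$-vector space with a nondegenerate Hermitian form $h$ (linear in the first variable). Let $\alpha\in K$ satisfy $\bar\alpha=-\alpha$ and $\operatorname{Im}\tau(\alpha)>0$ for all $\tau\in\Sigma$, and put $\langle v,w\rangle=\operatorname{Tr}_{K/\mathbb Q}(\alpha\,h(v,w))$. Let $L\subset V$ be an $\mathcal O_K$-lattice with $\langle L,L\rangle\subset\mathbb Z$. For $\tau\in\Sigma$ let $(m_\tau,n_\tau)$ be the signature of $h$ at $\tau$, and fix a basis of $V\otimes_{K,\tau}\mathbb C$ in which $h$ has matrix $\mathrm{diag}(1_{m_\tau},-1_{n_\tau})$; write $(v_{1,\tau},v_{2,\tau})\in\mathbb C^{m_\tau}\oplus\mathbb C^{n_\tau}$ for the resulting coordinates of $v\in V$. **Groups.** Let $GU$ be the $\mathbb Q$-group of $K$-linear similitudes of $(V,\langle\,,\rangle)$ with similitude factor in $\mathbb G_m$, and let $GU^+(\mathbb Q)$ consist of the $g\in GU(\mathbb Q)$ with positive similitude factor. Let $\mathcal K$ be a neat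 open compact subgroup of $GU(\mathbb A_f)$ and $\Gamma=\mathcal K\cap GU^+(\mathbb Q)$. Let $H(\mathbb C)=\prod_{\tau\in\Sigma}GL_{m_\tau}(\mathbb C)\times GL_{n_\tau}(\mathbb C)$, and let $\rho:H(\mathbb C)\to GL(X)$ be an algebraic representation on a finite-dimensional complex vector space $X$. **Automorphic functions.** Let $\mathcal H=\prod_{\tau\in\Sigma}\{z_\tau\in M_{m_\tau\times n_\tau}(\mathbb C): 1-{}^t\bar z_\tau z_\tau>0\}$. An element $g\in GU^+(\mathbb Q)$, with matrix $\begin{pmatrix}a_\tau&b_\tau\\c_\tau&d_\tau\end{pmatrix}$ at $\tau$, acts on $\mathcal H$ by $(gz)_\tau=(a_\tau z_\tau+b_\tau)(c_\tau z_\tau+d_\tau)^{-1}$. Put $M_g(z)=(\bar b_\tau{}^tz_\tau+\bar a_\tau,\ c_\tau z_\tau+d_\tau)_{\tau\in\Sigma}\in H(\mathbb C)$. An automorphic function of weight $\rho$ and level $\Gamma$ is a function $f:\mathcal H\to X$ with $\rho(M_\gamma(z))^{-1}f(\gamma z)=f(z)$ for all $\gamma\in\Gamma$ and $z\in\mathcal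 H$. **Abelian varieties.** A PEL variety $\underline A$ is a complex abelian variety $A$ with a polarization, a homomorphism $\iota:K\to\mathrm{End}(A)\otimes\mathbb Q$ satisfying the Rosati condition, and a $\mathcal K$-level structure, such that Kottwitz's determinant condition holds. Here a $\mathcal K$-level structure is a $\mathcal K$-orbit of $K$-linear isomorphisms $V\otimes\mathbb A_f\cong H_1(A,\mathbb A_f)$ matching $\langle\,,\rangle$ with the polarization form up to $\mathbb A_f^\times$. Two PEL varieties are equivalent if there is a quasi-isogeny between them that respects the polarizations up to $\mathbb Q^\times$, the actions of $K$, and the level structures. For $z\in\mathcal H$ let $$p_z:V\to\mathbb C^g=\prod_{\tau\in\Sigma}\mathbb C^{m_\tau}\times\mathbb C^{n_\tau},\qquad p_z(v)=\bigl(v_{1,\tau}-z_\tau v_{2,\tau},\ {}^tz_\tau\bar v_{1,\tau}-\bar v_{2,\tau}\bigr)_{\tau\in\Sigma},$$ and let $\underline A_z$ be $\mathbb C^g/p_z(L)$ with the polarization given by $\langle\,,\rangle$, the action of $K$ induced by that on $V$, and the level structure $\mathcal K\cdot\mathrm{id}$. Say that $\underline A$ is parametrized by $\Gamma\backslash\mathcal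 H$ if it is equivalent to some $\underline A_z$. Let $\Omega_{A}$ be the space of invariant differentials of $A$, and for an embedding $\tau:K\to\mathbb C$ let $\Omega_{A,\tau}$ be the part on which $K$ acts via $\tau$. Let $\mathcal E_{\underline A}$ be the set of families $\ell$ of $\mathbb C$-linear isomorphisms $\Omega_{A,\tau}\cong\mathbb C^{m_\tau}$ and $\Omega_{A,\bar\tau}\cong\mathbb C^{n_\tau}$ $(\tau\in\Sigma)$. The group $H(\mathbb C)$ acts on $\mathcal E_{\underline A}$ by $(g\ell)^{-1}(x)=\ell^{-1}({}^tg\,x)$, component by component. Let $\ell_z\in\mathcal E_{\underline A_z}$ send a differential to its coefficients with respect to the coordinate differentials of $\mathbb C^g$. Two pairs $(\underline A,\ell)$ and $(\underline A',\ell')$ are equivalent if there is a quasi-isogeny as above $\underline A\to\underline A'$ such that pulling back differentials along it carries $\ell$ to $\ell'$, that is, $\ell'(\omega)=\ell(\varphi^*\omega)$ where $\varphi$ is the quasi-isogeny. **Claim.** For every function $F$ with values in $X$ on the equivalence classes of pairs $(\underline A,\ell)$, with $\underline A$ parametrized by $\Gamma\backslash\mathcal H$ and $\ell\in\mathcal E_{\underline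 A}$, such that $$F(\underline A,g\ell)=\rho({}^tg)^{-1}F(\underline A,\ell)\qquad\text{for all }g\in H(\mathbb C),$$ the function $f_F(z)=F(\underline A_z,\ell_z)$ is an automorphic function on $\mathcal H$ of weight $\rho$ and level $\Gamma$. The map $F\mapsto f_F$ is a bijection from the set of such functions $F$ onto the set of $X$-valued automorphic functions on $\mathcal H$ of weight $\rho$ and level $\Gamma$. -/

import Mathlib

namespace UnitaryPEL

open scoped TensorProduct Matrix ComplexConjugate ComplexOrder
open NumberField Module

universe u v w

noncomputable section

/-! ### Bounded domains, similitudes of signature `(m, n)` and factors of automorphy -/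

section Local

variable {m n : ℕ}

/-- The matrix `I_{m,n} = diag(1_m, -1_n)`. -/
def signMat (m n : ℕ) : Matrix (Fin m ⊕ Fin n) (Fin m ⊕ Fin n) ℂ :=
  Matrix.fromBlocks 1 0 0 (-1)

/-- The condition `1 - ᵗz̄ z > 0` that defines the bounded domain `𝓗_{m,n}`. -/
def InDomain (z : Matrix (Fin m) (Fin n) ℂ) : Prop := (1 - zᴴ * z).PosDef

/-- Membership in `GU⁺(m, n)`: similitudes of `I_{m,n}` with positive similitude factor. -/
def IsPosSimilitude (g : Matrix (Fin m ⊕ Fin n) (Fin m ⊕ Fin n) ℂ) : Prop :=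
  ∃ r : ℝ, 0 < r ∧ gᴴ * signMat m n * g = (r : ℂ) • signMat m n

/-- The factor `λ(g, z) = b̄ ᵗz + ā` of `g = (a b; c d)`. If `n = 0` this is `ḡ`, and if `m = 0` it
is the empty matrix. -/
def lam (g : Matrix (Fin m ⊕ Fin n) (Fin m ⊕ Fin n) ℂ) (z : Matrix (Fin m) (Fin n) ℂ) :
    Matrix (Fin m) (Fin m) ℂ :=
  g.toBlocks₁₂.map conj * zᵀ + g.toBlocks₁₁.map conj

/-- The factor `μ(g, z) = c z + d` of `g = (a b; c d)`. If `m = 0` this is `g`, and if `n = 0` it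
is the empty matrix. -/
def mu (g : Matrix (Fin m ⊕ Fin n) (Fin m ⊕ Fin n) ℂ) (z : Matrix (Fin m) (Fin n) ℂ) :
    Matrix (Fin n) (Fin n) ℂ :=
  g.toBlocks₂₁ * z + g.toBlocks₂₂

/-- The action `g z = (a z + b) (c z + d)⁻¹`. -/
def moebius (g : Matrix (Fin m ⊕ Fin n) (Fin m ⊕ Fin n) ℂ) (z : Matrix (Fin m) (Fin n) ℂ) :
    Matrix (Fin m) (Fin n) ℂ :=
  (g.toBlocks₁₁ * z + g.toBlocks₁₂) * (mu g z)⁻¹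

theorem posSimilitude_blocks {g : Matrix (Fin m ⊕ Fin n) (Fin m ⊕ Fin n) ℂ} {r : ℝ}
    (h : gᴴ * signMat m n * g = (r : ℂ) • signMat m n) :
    (g.toBlocks₁₁ᴴ * g.toBlocks₁₁ - g.toBlocks₂₁ᴴ * g.toBlocks₂₁ = (r : ℂ) • 1) ∧
    (g.toBlocks₁₁ᴴ * g.toBlocks₁₂ - g.toBlocks₂₁ᴴ * g.toBlocks₂₂ = 0) ∧
    (g.toBlocks₁₂ᴴ * g.toBlocks₁₁ - g.toBlocks₂₂ᴴ * g.toBlocks₂₁ = 0) ∧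
    (g.toBlocks₁₂ᴴ * g.toBlocks₁₂ - g.toBlocks₂₂ᴴ * g.toBlocks₂₂ = -((r : ℂ) • 1)) := by
  rw [← Matrix.fromBlocks_toBlocks g] at h
  simp only [signMat, Matrix.fromBlocks_conjTranspose, Matrix.fromBlocks_multiply,
    Matrix.fromBlocks_smul, Matrix.fromBlocks_inj] at h
  simpa [sub_eq_add_neg] using h

theorem InDomain.swap {z : Matrix (Fin m) (Fin n) ℂ} (hz : InDomain z) :
    (1 + z * (1 - zᴴ * z)⁻¹ * zᴴ).PosDef ∧
      (1 - z * zᴴ) * (1 + z * (1 - zᴴ * z)⁻¹ * zᴴ) = 1 := by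
  have hu : IsUnit (1 - zᴴ * z) := Matrix.PosDef.isUnit hz
  have hu' : IsUnit (1 - zᴴ * z).det := (Matrix.isUnit_iff_isUnit_det _).1 hu
  constructor
  · refine Matrix.PosDef.one.add_posSemidef ?_
    have := (Matrix.PosDef.inv hz).posSemidef.mul_mul_conjTranspose_same z
    exact this
  · have h1 : (1 - zᴴ * z) * (1 - zᴴ * z)⁻¹ = 1 := Matrix.mul_nonsing_inv _ hu'
    set S := (1 - zᴴ * z)⁻¹
    have h2 : zᴴ * z * S = S - 1 := by
      rw [sub_mul, one_mul] at h1
      rw [← h1]; abel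
    have h3 : z * zᴴ * (z * S * zᴴ) = z * (zᴴ * z * S) * zᴴ := by
      simp only [Matrix.mul_assoc]
    rw [sub_mul, one_mul, mul_add, mul_one, h3, h2, Matrix.mul_sub, Matrix.sub_mul,
      Matrix.mul_one]
    abel

theorem InDomain.swap_posDef {z : Matrix (Fin m) (Fin n) ℂ} (hz : InDomain z) :
    (1 - z * zᴴ).PosDef := by
  obtain ⟨h1, h2⟩ := hz.swap
  rw [← Matrix.inv_eq_left_inv h2]
  exact h1.inv

theorem mu_gram {g : Matrix (Fin m ⊕ Fin n) (Fin m ⊕ Fin n) ℂ} {r : ℝ}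
    (h : gᴴ * signMat m n * g = (r : ℂ) • signMat m n) (z : Matrix (Fin m) (Fin n) ℂ) :
    (mu g z)ᴴ * mu g z = (r : ℂ) • (1 - zᴴ * z) +
      (g.toBlocks₁₁ * z + g.toBlocks₁₂)ᴴ * (g.toBlocks₁₁ * z + g.toBlocks₁₂) := by
  obtain ⟨h1, h2, h3, h4⟩ := posSimilitude_blocks h
  have key : (mu g z)ᴴ * mu g z - (g.toBlocks₁₁ * z + g.toBlocks₁₂)ᴴ *
      (g.toBlocks₁₁ * z + g.toBlocks₁₂) =
      -(zᴴ * (g.toBlocks₁₁ᴴ * g.toBlocks₁₁ - g.toBlocks₂₁ᴴ * g.toBlocks₂₁) * z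
      + zᴴ * (g.toBlocks₁₁ᴴ * g.toBlocks₁₂ - g.toBlocks₂₁ᴴ * g.toBlocks₂₂)
      + (g.toBlocks₁₂ᴴ * g.toBlocks₁₁ - g.toBlocks₂₂ᴴ * g.toBlocks₂₁) * z
      + (g.toBlocks₁₂ᴴ * g.toBlocks₁₂ - g.toBlocks₂₂ᴴ * g.toBlocks₂₂)) := by
    simp only [mu, Matrix.conjTranspose_add, Matrix.conjTranspose_mul, Matrix.add_mul,
      Matrix.mul_add, Matrix.mul_sub, Matrix.sub_mul, Matrix.mul_assoc]
    abel
  rw [h1, h2, h3, h4] at key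
  rw [sub_eq_iff_eq_add] at key
  rw [key]
  simp [sub_eq_add_neg, add_comm]

theorem lam_gram {g : Matrix (Fin m ⊕ Fin n) (Fin m ⊕ Fin n) ℂ} {r : ℝ}
    (h : gᴴ * signMat m n * g = (r : ℂ) • signMat m n) (z : Matrix (Fin m) (Fin n) ℂ) :
    (g.toBlocks₁₁ + g.toBlocks₁₂ * zᴴ)ᴴ * (g.toBlocks₁₁ + g.toBlocks₁₂ * zᴴ) =
      (r : ℂ) • (1 - z * zᴴ) +
      (g.toBlocks₂₁ + g.toBlocks₂₂ * zᴴ)ᴴ * (g.toBlocks₂₁ + g.toBlocks₂₂ * zᴴ) := by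
  obtain ⟨h1, h2, h3, h4⟩ := posSimilitude_blocks h
  have key : (g.toBlocks₁₁ + g.toBlocks₁₂ * zᴴ)ᴴ * (g.toBlocks₁₁ + g.toBlocks₁₂ * zᴴ) -
      (g.toBlocks₂₁ + g.toBlocks₂₂ * zᴴ)ᴴ * (g.toBlocks₂₁ + g.toBlocks₂₂ * zᴴ) =
      (g.toBlocks₁₁ᴴ * g.toBlocks₁₁ - g.toBlocks₂₁ᴴ * g.toBlocks₂₁)
      + (g.toBlocks₁₁ᴴ * g.toBlocks₁₂ - g.toBlocks₂₁ᴴ * g.toBlocks₂₂) * zᴴ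
      + z * (g.toBlocks₁₂ᴴ * g.toBlocks₁₁ - g.toBlocks₂₂ᴴ * g.toBlocks₂₁)
      + z * (g.toBlocks₁₂ᴴ * g.toBlocks₁₂ - g.toBlocks₂₂ᴴ * g.toBlocks₂₂) * zᴴ := by
    simp only [Matrix.conjTranspose_add, Matrix.conjTranspose_mul, Matrix.add_mul,
      Matrix.mul_add, Matrix.mul_sub, Matrix.sub_mul, Matrix.mul_assoc,
      Matrix.conjTranspose_conjTranspose]
    abel
  rw [h1, h2, h3, h4] at key
  rw [sub_eq_iff_eq_add] at key
  rw [key]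
  simp [sub_eq_add_neg]

theorem isUnit_det_of_gram {k l : ℕ} {r : ℝ} (hr : 0 < r) {A P : Matrix (Fin k) (Fin k) ℂ}
    {B : Matrix (Fin l) (Fin k) ℂ} (hP : P.PosDef) (h : Aᴴ * A = (r : ℂ) • P + Bᴴ * B) :
    IsUnit A.det := by
  have h1 : (Aᴴ * A).PosDef := by
    rw [h]
    exact (hP.smul (by exact_mod_cast hr : (0 : ℂ) < r)).add_posSemidef
      (Matrix.posSemidef_conjTranspose_mul_self B)
  have h2 := (Matrix.isUnit_iff_isUnit_det _).1 h1.isUnit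
  rw [Matrix.det_mul] at h2
  exact isUnit_of_mul_isUnit_right h2

theorem isUnit_det_mu {g : Matrix (Fin m ⊕ Fin n) (Fin m ⊕ Fin n) ℂ} (hg : IsPosSimilitude g)
    {z : Matrix (Fin m) (Fin n) ℂ} (hz : InDomain z) : IsUnit (mu g z).det := by
  obtain ⟨r, hr, h⟩ := hg
  exact isUnit_det_of_gram hr hz (mu_gram h z)

theorem isUnit_det_lam {g : Matrix (Fin m ⊕ Fin n) (Fin m ⊕ Fin n) ℂ} (hg : IsPosSimilitude g)
    {z : Matrix (Fin m) (Fin n) ℂ} (hz : InDomain z) : IsUnit (lam g z).det := by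
  obtain ⟨r, hr, h⟩ := hg
  have h1 := isUnit_det_of_gram hr hz.swap_posDef (lam_gram h z)
  have h2 : lam g z = (g.toBlocks₁₁ + g.toBlocks₁₂ * zᴴ).map (starRingEnd ℂ) := by
    rw [Matrix.map_add _ (map_add _), Matrix.map_mul, lam, add_comm]
    congr 2
    ext i j
    simp
  rw [h2, ← RingHom.mapMatrix_apply, ← RingHom.map_det]
  exact h1.map _

theorem inDomain_moebius {g : Matrix (Fin m ⊕ Fin n) (Fin m ⊕ Fin n) ℂ} (hg : IsPosSimilitude g)
    {z : Matrix (Fin m) (Fin n) ℂ} (hz : InDomain z) : InDomain (moebius g z) := by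
  have hu := isUnit_det_mu hg hz
  obtain ⟨r, hr, h⟩ := hg
  have hg := mu_gram h z
  have h1 : mu g z * (mu g z)⁻¹ = 1 := Matrix.mul_nonsing_inv _ hu
  have h1' : (mu g z)⁻¹ᴴ * (mu g z)ᴴ = 1 := by
    rw [← Matrix.conjTranspose_mul, h1, Matrix.conjTranspose_one]
  have h2 : 1 - (moebius g z)ᴴ * moebius g z =
      (mu g z)⁻¹ᴴ * ((r : ℂ) • (1 - zᴴ * z)) * (mu g z)⁻¹ := by
    rw [eq_sub_of_add_eq hg.symm, mul_sub, sub_mul]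
    have h3 : (mu g z)⁻¹ᴴ * ((mu g z)ᴴ * mu g z) * (mu g z)⁻¹ = 1 := by
      rw [← Matrix.mul_assoc, h1', one_mul, h1]
    rw [h3, moebius, Matrix.conjTranspose_mul]
    simp only [Matrix.mul_assoc]
  rw [InDomain, h2]
  refine Matrix.PosDef.conjTranspose_mul_mul_same
    (Matrix.PosDef.smul hz (by exact_mod_cast hr : (0 : ℂ) < r)) ?_
  intro x y hxy
  have := congrArg (fun t => mu g z *ᵥ t) hxy
  simpa [Matrix.mulVec_mulVec, h1] using this

end Local

/-! ### Unitary PEL data and their groups -/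

/-- A PEL datum of unitary type for the CM field `K`: a nondegenerate Hermitian space `(V, herm)`
over `K` (linear in the first variable), a totally imaginary `α` defining the alternating form
`⟨v, w⟩ = Tr_{K/ℚ} (α herm(v, w))`, a CM type, for each `τ` in the CM type a basis of `V ⊗_{K,τ} ℂ`
for which the Hermitian form has matrix `diag(1_m, -1_n)`, and an integral `𝓞_K`-lattice `L`.

The basis at `τ` is recorded by the coordinate map `frame τ : V → ℂ^m ⊕ ℂ^n`. The homomorphism `h`
of the PEL datum is `h(z) = diag(z 1_m, z̄ 1_n)` in these coordinates; the condition `α_pos` says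
that `⟨·, h(i) ·⟩` is positive definite. -/
structure Datum (K : Type u) [Field K] [NumberField K] [IsCMField K]
    (V : Type v) [AddCommGroup V] [Module K V] [Module ℚ V] [IsScalarTower ℚ K V]
    [FiniteDimensional ℚ V] where
  herm : V →ₗ[K] (V → K)
  herm_conj : ∀ v w, IsCMField.complexConj K (herm v w) = herm w v
  herm_nondegenerate : ∀ v, (∀ w, herm v w = 0) → v = 0
  cmType : Finset (K →+* ℂ)
  cmType_spec : ∀ τ : K →+* ℂ, Xor (τ ∈ cmType) (ComplexEmbedding.conjugate τ ∈ cmType)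
  α : K
  α_conj : IsCMField.complexConj K α = -α
  α_pos : ∀ τ ∈ cmType, 0 < (τ α).im
  /-- The signature at `τ` is `(m τ, n τ)`. -/
  m : cmType → ℕ
  n : cmType → ℕ
  frame : ∀ τ : cmType, V →ₛₗ[(τ : K →+* ℂ)] (Fin (m τ) ⊕ Fin (n τ) → ℂ)
  frame_rank : ∀ τ, m τ + n τ = finrank K V
  frame_span : ∀ τ, Submodule.span ℂ (Set.range (frame τ)) = ⊤
  frame_herm : ∀ (τ : cmType) (v w : V), (τ : K →+* ℂ) (herm v w) =
    star (frame τ w) ⬝ᵥ signMat (m τ) (n τ) *ᵥ frame τ v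
  L : Submodule ℤ V
  L_smul : ∀ b : 𝓞 K, ∀ x ∈ L, (b : K) • x ∈ L
  L_fg : L.FG
  L_span : Submodule.span ℚ (L : Set V) = ⊤
  L_integral : ∀ x ∈ L, ∀ y ∈ L, ∃ k : ℤ, Algebra.trace ℚ K (α * herm x y) = k

/-- The finite adeles `𝔸_f` of `ℚ`. -/
abbrev FinAdele : Type := IsDedekindDomain.FiniteAdeleRing ℤ ℚ

/-- The `v`-component of a finite adele, as a ring homomorphism. -/
def evalPlace (v : IsDedekindDomain.HeightOneSpectrum ℤ) : FinAdele →+* v.adicCompletion ℚ where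
  toFun a := a v
  map_one' := rfl
  map_mul' _ _ := rfl
  map_zero' := rfl
  map_add' _ _ := rfl

section Adelic

variable (V : Type v) [AddCommGroup V] [Module ℚ V]

/-- The group `GL(V ⊗ 𝔸_f)`. -/
abbrev AdelicGL : Type v := (FinAdele ⊗[ℚ] V) ≃ₗ[FinAdele] (FinAdele ⊗[ℚ] V)

/-- The topology of `GL(V ⊗ 𝔸_f)`: it is induced by the embedding `g ↦ (g, g⁻¹)` into
`End(V ⊗ 𝔸_f) × End(V ⊗ 𝔸_f)`, where `End(V ⊗ 𝔸_f)`, a free `𝔸_f`-module of finite rank, carries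
the module topology. -/
@[reducible]
def adelicTopology : TopologicalSpace (AdelicGL V) :=
  letI : TopologicalSpace (Module.End FinAdele (FinAdele ⊗[ℚ] V)) :=
    moduleTopology FinAdele (Module.End FinAdele (FinAdele ⊗[ℚ] V))
  TopologicalSpace.induced
    (fun g : AdelicGL V => (g.toLinearMap, g.symm.toLinearMap)) inferInstance

variable {V} [FiniteDimensional ℚ V]

/-- For `g ∈ GL(V ⊗ 𝔸_f)`, the subgroup of `ℚ̄_pˣ` generated by the eigenvalues of the component
`g_p`. -/
def eigenvalueGroup (g : AdelicGL V) (v : IsDedekindDomain.HeightOneSpectrum ℤ) :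
    Subgroup (AlgebraicClosure (v.adicCompletion ℚ))ˣ :=
  Subgroup.closure {x | (((LinearMap.charpoly g.toLinearMap).map (evalPlace v)).map
    (algebraMap (v.adicCompletion ℚ) (AlgebraicClosure (v.adicCompletion ℚ)))).IsRoot x}

/-- `g` is neat: the intersection over all `p` of the groups of algebraic eigenvalues of `g_p` is
torsion free, that is, no root of unity except `1` occurs in the eigenvalue groups at all `p`. -/
def IsNeatElement (g : AdelicGL V) : Prop :=
  ∀ d : ℕ, 0 < d → (∀ v, ∃ ζ ∈ eigenvalueGroup g v, IsPrimitiveRoot ζ d) → d = 1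

/-- A subgroup is neat if all its elements are. -/
def IsNeat (𝒦 : Subgroup (AdelicGL V)) : Prop := ∀ g ∈ 𝒦, IsNeatElement g

end Adelic

namespace Datum

variable {K : Type u} [Field K] [NumberField K] [IsCMField K]
    {V : Type v} [AddCommGroup V] [Module K V] [Module ℚ V] [IsScalarTower ℚ K V]
    [FiniteDimensional ℚ V]

theorem herm_add_right (D : Datum K V) (v w w' : V) :
    D.herm v (w + w') = D.herm v w + D.herm v w' := by
  rw [← D.herm_conj, map_add, Pi.add_apply, map_add, D.herm_conj, D.herm_conj]

theorem herm_smul_right (D : Datum K V) (b : K) (v w : V) :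
    D.herm v (b • w) = IsCMField.complexConj K b * D.herm v w := by
  rw [← D.herm_conj, map_smul, Pi.smul_apply, smul_eq_mul, map_mul, D.herm_conj]

theorem complexConj_algebraMap (q : ℚ) :
    IsCMField.complexConj K (algebraMap ℚ K q) = algebraMap ℚ K q := by
  simp

/-- The alternating form `⟨v, w⟩ = Tr_{K/ℚ} (α herm(v, w))` on the rational vector space `V`. -/
def psi (D : Datum K V) : LinearMap.BilinForm ℚ V :=
  LinearMap.mk₂ ℚ (fun v w => Algebra.trace ℚ K (D.α * D.herm v w))
    (fun v v' w => by simp [mul_add])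
    (fun q v w => by
      rw [← algebraMap_smul K q v, map_smul, Pi.smul_apply, smul_eq_mul, mul_left_comm,
        ← Algebra.smul_def, map_smul])
    (fun v w w' => by rw [D.herm_add_right, mul_add, map_add])
    (fun q v w => by
      rw [← algebraMap_smul K q w, D.herm_smul_right, complexConj_algebraMap, mul_left_comm,
        ← Algebra.smul_def, map_smul])

/-- `(V, psi)` extended to the finite adeles. -/
def psiAdelic (D : Datum K V) : LinearMap.BilinForm FinAdele (FinAdele ⊗[ℚ] V) :=
  D.psi.baseChange FinAdele

/-- The group `GU(𝔸_f)` of `K`-linear similitudes of `V ⊗ 𝔸_f`. -/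
def GUAdelic (D : Datum K V) : Subgroup (AdelicGL V) where
  carrier := {g | (∀ (b : K) x, g ((Algebra.lsmul ℚ ℚ V b).baseChange FinAdele x) =
      (Algebra.lsmul ℚ ℚ V b).baseChange FinAdele (g x)) ∧
    ∃ r : FinAdeleˣ, ∀ x y, D.psiAdelic (g x) (g y) = r * D.psiAdelic x y}
  one_mem' := ⟨fun _ _ => rfl, 1, fun x y => by simp⟩
  mul_mem' := by
    rintro g h ⟨hg, r, hr⟩ ⟨hh, s, hs⟩
    refine ⟨fun b x => ?_, r * s, fun x y => ?_⟩
    · rw [LinearEquiv.mul_apply, LinearEquiv.mul_apply, hh, hg]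
    · rw [LinearEquiv.mul_apply, LinearEquiv.mul_apply, hr, hs, Units.val_mul, mul_assoc]
  inv_mem' := by
    rintro g ⟨hg, r, hr⟩
    refine ⟨fun b x => ?_, r⁻¹, fun x y => ?_⟩
    · apply g.injective
      rw [hg]
      simp
    · rw [Units.eq_inv_mul_iff_mul_eq, ← hr]
      simp

/-- The group `GU⁺(ℚ)` of `K`-linear similitudes of `V` whose similitude factor is a positive
rational number. -/
def GUPos (D : Datum K V) : Subgroup (V ≃ₗ[K] V) where
  carrier := {g | ∃ r : ℚ, 0 < r ∧ ∀ x y, D.psi (g x) (g y) = r * D.psi x y}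
  one_mem' := ⟨1, one_pos, fun x y => by simp⟩
  mul_mem' := by
    rintro g h ⟨r, hr0, hr⟩ ⟨s, hs0, hs⟩
    refine ⟨r * s, mul_pos hr0 hs0, fun x y => ?_⟩
    rw [LinearEquiv.mul_apply, LinearEquiv.mul_apply, hr, hs, mul_assoc]
  inv_mem' := by
    rintro g ⟨r, hr0, hr⟩
    refine ⟨r⁻¹, inv_pos.2 hr0, fun x y => ?_⟩
    rw [eq_inv_mul_iff_mul_eq₀ hr0.ne', ← hr]
    simp

/-- The embedding of `GL_K(V)` into `GL(V ⊗ 𝔸_f)`. -/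
def toAdelic : (V ≃ₗ[K] V) →* AdelicGL V where
  toFun g := (g.restrictScalars ℚ).baseChange ℚ FinAdele V V
  map_one' := by
    ext x
    induction x with
    | zero => simp
    | tmul a y => rfl
    | add a b ha hb => rw [map_add, ha, hb, map_add]
  map_mul' g h := by
    ext x
    induction x with
    | zero => simp
    | tmul a y => rfl
    | add a b ha hb => rw [map_add, ha, hb, map_add]

/-- The group `Γ = 𝒦 ∩ GU⁺(ℚ)`. -/
def Gamma (D : Datum K V) (𝒦 : Subgroup (AdelicGL V)) : Subgroup D.GUPos :=
  𝒦.comap (toAdelic.comp D.GUPos.subtype)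

/-- `𝒦` is an open compact subgroup of `GU(𝔸_f)`. -/
def IsOpenCompact (D : Datum K V) (𝒦 : Subgroup (AdelicGL V)) : Prop :=
  𝒦 ≤ D.GUAdelic ∧ @IsCompact _ (adelicTopology V) (𝒦 : Set (AdelicGL V)) ∧
    ∃ U : Set (AdelicGL V), @IsOpen _ (adelicTopology V) U ∧
      U ∩ (D.GUAdelic : Set (AdelicGL V)) = 𝒦

/-! ### The symmetric space, the action of `GU⁺(ℚ)`, and automorphic functions -/

theorem finite_of_rat (K : Type u) [Field K] [NumberField K] (V : Type v) [AddCommGroup V]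
    [Module K V] [Module ℚ V] [IsScalarTower ℚ K V] [FiniteDimensional ℚ V] :
    FiniteDimensional K V :=
  Module.Finite.of_restrictScalars_finite ℚ K V

theorem frame_span_basis (D : Datum K V) (τ : D.cmType) {ι : Type*} (b : Basis ι K V) :
    ⊤ ≤ Submodule.span ℂ (Set.range fun i => D.frame τ (b i)) := by
  rw [← D.frame_span τ, Submodule.span_le]
  rintro _ ⟨v, rfl⟩
  have hv : v ∈ Submodule.span K (Set.range b) := by rw [b.span_eq]; trivial
  induction hv using Submodule.span_induction with
  | mem x hx =>
    obtain ⟨i, rfl⟩ := hx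
    exact Submodule.subset_span ⟨i, rfl⟩
  | zero => rw [map_zero]; exact Submodule.zero_mem _
  | add x y _ _ hx hy => rw [map_add]; exact Submodule.add_mem _ hx hy
  | smul a x _ hx => rw [map_smulₛₗ]; exact Submodule.smul_mem _ _ hx

/-- The basis of `ℂ^m ⊕ ℂ^n` formed by the coordinate vectors of a `K`-basis of `V`. -/
def frameBasis (D : Datum K V) (τ : D.cmType) :
    Basis (Fin (finrank K V)) ℂ (Fin (D.m τ) ⊕ Fin (D.n τ) → ℂ) :=
  haveI := finite_of_rat K V
  basisOfTopLeSpanOfCardEqFinrank (fun i => D.frame τ (Module.finBasis K V i))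
    (D.frame_span_basis τ _) (by simp [D.frame_rank τ])

/-- The matrix of `g ∈ GL_K(V)` acting on `V ⊗_{K,τ} ℂ = ℂ^m ⊕ ℂ^n`. -/
def localMatrix (D : Datum K V) (τ : D.cmType) (g : V ≃ₗ[K] V) :
    Matrix (Fin (D.m τ) ⊕ Fin (D.n τ)) (Fin (D.m τ) ⊕ Fin (D.n τ)) ℂ :=
  haveI := finite_of_rat K V
  LinearMap.toMatrix' ((D.frameBasis τ).constr ℂ
    fun i => D.frame τ (g (Module.finBasis K V i)))

/-- `localMatrix` is characterised by its action on the coordinate vectors. -/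
theorem localMatrix_mulVec (D : Datum K V) (τ : D.cmType) (g : V ≃ₗ[K] V) (v : V) :
    D.localMatrix τ g *ᵥ D.frame τ v = D.frame τ (g v) := by
  have := finite_of_rat K V
  rw [localMatrix, ← Matrix.toLin'_apply, Matrix.toLin'_toMatrix']
  have hv : v ∈ Submodule.span K (Set.range (Module.finBasis K V)) := by
    rw [Basis.span_eq]; trivial
  induction hv using Submodule.span_induction with
  | mem x hx =>
    obtain ⟨i, rfl⟩ := hx
    have h : D.frame τ (Module.finBasis K V i) = D.frameBasis τ i := by
      simp [frameBasis]
    rw [h, Basis.constr_basis]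
  | zero => simp
  | add x y _ _ hx hy => simp only [map_add, hx, hy]
  | smul a x _ hx => simp only [map_smulₛₗ, hx, RingHom.id_apply]

theorem α_ne_zero (D : Datum K V) : D.α ≠ 0 := by
  intro h0
  obtain ⟨τ⟩ : Nonempty (K →+* ℂ) := inferInstance
  rcases D.cmType_spec τ with ⟨h1, -⟩ | ⟨h1, -⟩ <;>
  · have := D.α_pos _ h1
    simp [h0] at this

theorem herm_similitude (D : Datum K V) {g : V ≃ₗ[K] V} {r : ℚ}
    (h : ∀ x y, D.psi (g x) (g y) = r * D.psi x y) (v w : V) :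
    D.herm (g v) (g w) = (r : K) * D.herm v w := by
  have key : ∀ b : K, Algebra.traceForm ℚ K
      (D.α * (D.herm (g v) (g w) - (r : K) * D.herm v w)) b = 0 := by
    intro b
    have := h (b • v) w
    simp only [psi, LinearMap.mk₂_apply, map_smul, Pi.smul_apply, smul_eq_mul] at this
    rw [Algebra.traceForm_apply]
    rw [← smul_eq_mul r, ← map_smul, ← sub_eq_zero, ← map_sub] at this
    rw [← this]
    congr 1
    rw [Algebra.smul_def, eq_ratCast]
    ring
  have := (traceForm_nondegenerate ℚ K).1 _ key
  exact sub_eq_zero.1 ((mul_eq_zero.1 this).resolve_left D.α_ne_zero)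

theorem isPosSimilitude_localMatrix (D : Datum K V) (τ : D.cmType) (g : D.GUPos) :
    IsPosSimilitude (D.localMatrix τ g.1) := by
  obtain ⟨g, r, hr, h⟩ := g
  refine ⟨r, by exact_mod_cast hr, ?_⟩
  rw [← sub_eq_zero]
  set N := (D.localMatrix τ g)ᴴ * signMat _ _ * D.localMatrix τ g -
    (((r : ℝ) : ℂ) • signMat (D.m τ) (D.n τ)) with hN
  have h0 : ∀ v w, star (D.frame τ w) ⬝ᵥ N *ᵥ D.frame τ v = 0 := by
    intro v w
    have h1 := congrArg (τ : K →+* ℂ) (D.herm_similitude h v w)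
    rw [map_mul, D.frame_herm, D.frame_herm, ← D.localMatrix_mulVec, ← D.localMatrix_mulVec] at h1
    rw [hN, Matrix.sub_mulVec, dotProduct_sub, Matrix.smul_mulVec, dotProduct_smul, sub_eq_zero,
      ← Matrix.mulVec_mulVec, ← Matrix.mulVec_mulVec, Matrix.dotProduct_mulVec,
      ← Matrix.star_mulVec, h1]
    simp
  have h1 : ∀ x w, star (D.frame τ w) ⬝ᵥ N *ᵥ x = 0 := by
    intro x w
    have hx : x ∈ Submodule.span ℂ (Set.range (D.frame τ)) := by rw [D.frame_span]; trivial
    induction hx using Submodule.span_induction with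
    | mem x hx => obtain ⟨v, rfl⟩ := hx; exact h0 v w
    | zero => simp
    | add x y _ _ hx hy => rw [Matrix.mulVec_add, dotProduct_add, hx, hy, add_zero]
    | smul a x _ hx => rw [Matrix.mulVec_smul, dotProduct_smul, hx, smul_zero]
  have h2 : ∀ x y, star y ⬝ᵥ N *ᵥ x = 0 := by
    intro x y
    have hy : y ∈ Submodule.span ℂ (Set.range (D.frame τ)) := by rw [D.frame_span]; trivial
    induction hy using Submodule.span_induction with
    | mem y hy => obtain ⟨v, rfl⟩ := hy; exact h1 x v
    | zero => simp
    | add y y' _ _ hx hy => rw [star_add, add_dotProduct, hx, hy, add_zero]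
    | smul a y _ hx => rw [star_smul, smul_dotProduct, hx, smul_zero]
  ext i j
  have := h2 (Pi.single j 1) (Pi.single i 1)
  simpa using this

/-- The Hermitian symmetric space `𝓗 = ∏_τ 𝓗_{m_τ, n_τ}`. -/
def Domain (D : Datum K V) : Type u :=
  {z : ∀ τ : D.cmType, Matrix (Fin (D.m τ)) (Fin (D.n τ)) ℂ // ∀ τ, InDomain (z τ)}

/-- The action of `GU⁺(ℚ)` on `𝓗`. -/
def act (D : Datum K V) (g : D.GUPos) (z : D.Domain) : D.Domain :=
  ⟨fun τ => moebius (D.localMatrix τ g.1) (z.1 τ),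
    fun τ => inDomain_moebius (D.isPosSimilitude_localMatrix τ g) (z.2 τ)⟩

/-- The group `H(ℂ) = ∏_τ GL_{m_τ}(ℂ) × GL_{n_τ}(ℂ)`. -/
abbrev H (D : Datum K V) : Type u :=
  ∀ τ : D.cmType, GL (Fin (D.m τ)) ℂ × GL (Fin (D.n τ)) ℂ

/-- The factor of automorphy `M_g(z) = (λ_τ(g, z), μ_τ(g, z))_τ`. -/
def autFactor (D : Datum K V) (g : D.GUPos) (z : D.Domain) : D.H := fun τ =>
  (Matrix.GeneralLinearGroup.mk'' (lam (D.localMatrix τ g.1) (z.1 τ))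
      (isUnit_det_lam (D.isPosSimilitude_localMatrix τ g) (z.2 τ)),
    Matrix.GeneralLinearGroup.mk'' (mu (D.localMatrix τ g.1) (z.1 τ))
      (isUnit_det_mu (D.isPosSimilitude_localMatrix τ g) (z.2 τ)))

/-- The algebra `ℂ[H]` of regular functions on `H(ℂ)`: it is generated by the matrix entries of all
components and the inverses of their determinants. -/
def regularFunctions (D : Datum K V) : Subalgebra ℂ (D.H → ℂ) :=
  Algebra.adjoin ℂ
    ({φ | ∃ τ i j, φ = fun g => (g τ).1.val i j} ∪ {φ | ∃ τ i j, φ = fun g => (g τ).2.val i j} ∪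
      {φ | ∃ τ, φ = fun g => ((g τ).1.val.det)⁻¹} ∪ {φ | ∃ τ, φ = fun g => ((g τ).2.val.det)⁻¹})

section Weight

variable {X : Type w} [AddCommGroup X] [Module ℂ X]

/-- A representation of `H(ℂ)` is algebraic if its matrix coefficients are regular functions. -/
def IsAlgebraicRep (D : Datum K V) (ρ : Representation ℂ D.H X) : Prop :=
  ∀ (x : X) (ξ : Module.Dual ℂ X), (fun g => ξ (ρ g x)) ∈ D.regularFunctions

/-- `(f ‖_ρ g)(z) = ρ(M_g(z))⁻¹ f(g z)`. -/
def slash (D : Datum K V) (ρ : Representation ℂ D.H X) (f : D.Domain → X) (g : D.GUPos) :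
    D.Domain → X :=
  fun z => ρ (D.autFactor g z)⁻¹ (f (D.act g z))

/-- Automorphic functions of weight `ρ` and level `Γ = 𝒦 ∩ GU⁺(ℚ)`. -/
def IsAutomorphicFunction (D : Datum K V) (𝒦 : Subgroup (AdelicGL V))
    (ρ : Representation ℂ D.H X) (f : D.Domain → X) : Prop :=
  ∀ γ ∈ D.Gamma 𝒦, D.slash ρ f γ = f

end Weight

end Datum

/-! ### Abelian varieties with PEL structure -/

section Varieties

variable {K : Type u} [Field K] [NumberField K] [IsCMField K]
    {V : Type v} [AddCommGroup V] [Module K V] [Module ℚ V] [IsScalarTower ℚ K V]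
    [FiniteDimensional ℚ V]

/-- A complex abelian variety `A` with polarization, endomorphism and level `𝒦` structure (a tuple
`(A, λ, ι, η)` of the PEL moduli problem over `ℂ`).
`A` is the complex torus `Lie / per(lattice)`: here `H1 = H₁(A, ℚ)`, `lattice = H₁(A, ℤ)`, `Lie` is
the Lie algebra, and `per : H₁(A, ℚ) → Lie` is the period map, which induces an isomorphism
`H₁(A, ℚ) ⊗ ℝ ≅ Lie`. -/
structure PELVariety (D : Datum K V) (𝒦 : Subgroup (AdelicGL V)) where
  H1 : Type v
  [addCommGroupH1 : AddCommGroup H1]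
  [moduleH1 : Module ℚ H1]
  [finiteH1 : FiniteDimensional ℚ H1]
  Lie : Type u
  [addCommGroupLie : AddCommGroup Lie]
  [moduleLie : Module ℂ Lie]
  [finiteLie : FiniteDimensional ℂ Lie]
  lattice : Submodule ℤ H1
  lattice_fg : lattice.FG
  lattice_span : Submodule.span ℚ (lattice : Set H1) = ⊤
  per : H1 →+ Lie
  per_finrank : finrank ℚ H1 = finrank ℝ Lie
  per_span : Submodule.span ℝ (Set.range per) = ⊤
  /-- The polarization, given by its Riemann form. -/
  pol : LinearMap.BilinForm ℚ H1
  pol_alt : ∀ x, pol x x = 0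
  pol_integral : ∀ x ∈ lattice, ∀ y ∈ lattice, ∃ k : ℤ, pol x y = k
  pol_riemann : ∃ E : Lie →ₗ[ℝ] Lie →ₗ[ℝ] ℝ, (∀ x y, E (per x) (per y) = pol x y) ∧
    (∀ p q, E (Complex.I • p) (Complex.I • q) = E p q) ∧ ∀ p, p ≠ 0 → 0 < E p (Complex.I • p)
  /-- The homomorphism `ι : K → End(A) ⊗ ℚ`. An element of `End(A) ⊗ ℚ` is a pair of endomorphisms
  of `H₁(A, ℚ)` and of `Lie` that are compatible with the period map. -/
  ι : K →+* Module.End ℚ H1 × Module.End ℂ Lie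
  ι_per : ∀ b x, per ((ι b).1 x) = (ι b).2 (per x)
  rosati : ∀ b x y, pol ((ι b).1 x) y = pol x ((ι (IsCMField.complexConj K b)).1 y)
  /-- The level structure: a `𝒦`-orbit of `K`-linear isomorphisms `V ⊗ 𝔸_f ≅ H₁(A, 𝔸_f)` that
  match the alternating forms up to a unit of `𝔸_f`. -/
  level : Set ((FinAdele ⊗[ℚ] V) ≃ₗ[FinAdele] (FinAdele ⊗[ℚ] H1))
  level_spec : ∃ η : (FinAdele ⊗[ℚ] V) ≃ₗ[FinAdele] (FinAdele ⊗[ℚ] H1),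
    (∀ (b : K) x, η ((Algebra.lsmul ℚ ℚ V b).baseChange FinAdele x) =
      (ι b).1.baseChange FinAdele (η x)) ∧
    (∃ r : FinAdeleˣ, ∀ x y, pol.baseChange FinAdele (η x) (η y) = r * D.psiAdelic x y) ∧
    level = {η' | ∃ k ∈ 𝒦, η' = k.trans η}
  /-- Kottwitz's determinant condition, in terms of the multiplicities of the embeddings of `K` in
  the Lie algebra. -/
  kottwitz : ∀ τ : D.cmType,
    finrank ℂ (⨅ b : K, Module.End.eigenspace (ι b).2 ((τ : K →+* ℂ) b) : Submodule ℂ Lie) =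
      D.m τ ∧
    finrank ℂ (⨅ b : K, Module.End.eigenspace (ι b).2
      (ComplexEmbedding.conjugate (τ : K →+* ℂ) b) : Submodule ℂ Lie) = D.n τ

attribute [instance] PELVariety.addCommGroupH1 PELVariety.moduleH1 PELVariety.finiteH1
  PELVariety.addCommGroupLie PELVariety.moduleLie PELVariety.finiteLie

namespace PELVariety

variable {D : Datum K V} {𝒦 : Subgroup (AdelicGL V)}

/-- The part `Ω_τ` of the space `Ω = Hom_ℂ(Lie A, ℂ)` of invariant differentials on which `K` acts
via the embedding `τ`. -/
def Omega (A : PELVariety D 𝒦) (τ : K →+* ℂ) : Submodule ℂ (Module.Dual ℂ A.Lie) where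
  carrier := {ω | ∀ b p, ω ((A.ι b).2 p) = τ b * ω p}
  zero_mem' := by simp
  add_mem' := by
    intro ω ω' h h' b p
    simp [h b p, h' b p, mul_add]
  smul_mem' := by
    intro c ω h b p
    simp [h b p, mul_left_comm]

/-- The set `ℰ_A = ⊕_τ Isom_ℂ(Ω_τ, ℂ^{a_τ})`, over all embeddings `τ` of `K`. The embeddings outside
the CM type are the conjugates of those in the CM type, and `a_τ = m τ`, `a_{τ̄} = n τ` for `τ` in
the CM type. -/
def Frames (A : PELVariety D 𝒦) : Type u :=
  ∀ τ : D.cmType, (A.Omega τ ≃ₗ[ℂ] (Fin (D.m τ) → ℂ)) ×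
    (A.Omega (ComplexEmbedding.conjugate (τ : K →+* ℂ)) ≃ₗ[ℂ] (Fin (D.n τ) → ℂ))

end PELVariety

/-- The transpose of an invertible matrix. -/
def glTranspose {k : ℕ} (g : GL (Fin k) ℂ) : GL (Fin k) ℂ where
  val := (g.val)ᵀ
  inv := (g⁻¹.val)ᵀ
  val_inv := by rw [← Matrix.transpose_mul, ← Units.val_mul, inv_mul_cancel]; simp
  inv_val := by rw [← Matrix.transpose_mul, ← Units.val_mul, mul_inv_cancel]; simp

/-- The linear automorphism `x ↦ g x` of `ℂ^k`. -/
def glEquiv {k : ℕ} (g : GL (Fin k) ℂ) : (Fin k → ℂ) ≃ₗ[ℂ] (Fin k → ℂ) :=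
  Matrix.toLin'OfInv (M := g⁻¹.val) (M' := g.val)
    (by rw [← Units.val_mul, inv_mul_cancel]; rfl) (by rw [← Units.val_mul, mul_inv_cancel]; rfl)

theorem glEquiv_apply {k : ℕ} (g : GL (Fin k) ℂ) (x : Fin k → ℂ) : glEquiv g x = g.val *ᵥ x :=
  rfl

/-- The transpose `ᵗg` of an element of `H(ℂ)`, component by component. -/
def Datum.transpose {D : Datum K V} (g : D.H) : D.H :=
  fun τ => (glTranspose (g τ).1, glTranspose (g τ).2)

namespace PELVariety

variable {D : Datum K V} {𝒦 : Subgroup (AdelicGL V)}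

/-- The action of `H(ℂ)` on `ℰ_A`: in terms of the inverse isomorphisms `ℂ^{a_τ} → Ω_τ`, it is
`(g ℓ)_τ(x) = ℓ_τ(ᵗg_τ x)`. -/
def Frames.smul {A : PELVariety D 𝒦} (g : D.H) (l : A.Frames) : A.Frames := fun τ =>
  (((glEquiv (glTranspose (g τ).1)).trans (l τ).1.symm).symm,
    ((glEquiv (glTranspose (g τ).2)).trans (l τ).2.symm).symm)

/-- An isogeny (more precisely a quasi-isogeny) of PEL varieties, given by its effect on rational
homology and on Lie algebras: it respects the polarizations up to a nonzero rational factor, the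
actions of `K` and the level structures. -/
structure Isogeny (A B : PELVariety D 𝒦) where
  onH1 : A.H1 ≃ₗ[ℚ] B.H1
  onLie : A.Lie ≃ₗ[ℂ] B.Lie
  per_comm : ∀ x, B.per (onH1 x) = onLie (A.per x)
  pol : ∃ r : ℚ, r ≠ 0 ∧ ∀ x y, A.pol x y = r * B.pol (onH1 x) (onH1 y)
  ι_H1 : ∀ b x, onH1 ((A.ι b).1 x) = (B.ι b).1 (onH1 x)
  ι_Lie : ∀ b p, onLie ((A.ι b).2 p) = (B.ι b).2 (onLie p)
  level : B.level =
    {η' | ∃ η ∈ A.level, η' = η.trans (onH1.baseChange ℚ FinAdele A.H1 B.H1)}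

/-- The pull-back of invariant differentials along an isogeny. -/
def Isogeny.pullback {A B : PELVariety D 𝒦} (φ : Isogeny A B) (τ : K →+* ℂ) (ω : B.Omega τ) :
    A.Omega τ :=
  ⟨ω.1 ∘ₗ (φ.onLie : A.Lie →ₗ[ℂ] B.Lie), fun b p => by
    have := ω.2 b (φ.onLie p)
    simpa [φ.ι_Lie] using this⟩

end PELVariety

end Varieties

/-! ### The family of PEL varieties over the symmetric space -/

section Coordinates

variable {K : Type u} [Field K] {I J : Type*}

/-- The diagonal action of `K` on `ℂ^I` through embeddings `χ i : K → ℂ`. -/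
def diagAct (χ : I → K →+* ℂ) : K →+* Module.End ℂ (I → ℂ) where
  toFun b :=
    { toFun := fun p i => χ i b * p i
      map_add' := fun p q => by ext i; simp [mul_add]
      map_smul' := fun c p => by ext i; simp [mul_left_comm] }
  map_one' := by ext; simp
  map_mul' b c := LinearMap.ext fun p => funext fun i => by simp [mul_assoc]
  map_zero' := LinearMap.ext fun p => funext fun i => by simp
  map_add' b c := LinearMap.ext fun p => funext fun i => by simp [add_mul]

theorem diagAct_apply (χ : I → K →+* ℂ) (b : K) (p : I → ℂ) (i : I) :
    diagAct χ b p i = χ i b * p i := rfl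

theorem finrank_eigen [Fintype J] (χ : I → K →+* ℂ) (τ : K →+* ℂ) (e : J → I) (he : Function.Injective e)
    (h : ∀ i, χ i = τ ↔ i ∈ Set.range e) :
    finrank ℂ (⨅ b : K, Module.End.eigenspace (diagAct χ b) (τ b) : Submodule ℂ (I → ℂ)) =
      Fintype.card J := by
  have hmem : ∀ p : I → ℂ, p ∈ (⨅ b : K, Module.End.eigenspace (diagAct χ b) (τ b)) ↔
      ∀ i, i ∉ Set.range e → p i = 0 := by
    intro p
    simp only [Submodule.mem_iInf, Module.End.mem_eigenspace_iff, funext_iff, diagAct_apply,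
      Pi.smul_apply, smul_eq_mul, mul_eq_mul_right_iff]
    constructor
    · intro hp i hi
      by_contra h0
      exact hi ((h i).1 (RingHom.ext fun b => (hp b i).resolve_right h0))
    · intro hp b i
      by_cases hi : i ∈ Set.range e
      · left; rw [(h i).2 hi]
      · right; exact hp i hi
  let f : (⨅ b : K, Module.End.eigenspace (diagAct χ b) (τ b) : Submodule ℂ (I → ℂ)) →ₗ[ℂ]
      (J → ℂ) := (LinearMap.funLeft ℂ ℂ e) ∘ₗ Submodule.subtype _
  have hf : Function.Bijective f := by
    constructor
    · rw [injective_iff_map_eq_zero]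
      rintro ⟨p, hp⟩ h0
      ext i
      by_cases hi : i ∈ Set.range e
      · obtain ⟨j, rfl⟩ := hi
        exact congrFun h0 j
      · exact (hmem p).1 hp i hi
    · intro c
      refine ⟨⟨Function.extend e c 0, (hmem _).2 fun i hi => ?_⟩, ?_⟩
      · rw [Function.extend_apply' _ _ _ (by simpa using hi)]; rfl
      · ext j
        exact he.extend_apply _ _ _
  rw [(LinearEquiv.ofBijective f hf).finrank_eq, finrank_fintype_fun_eq_card]

/-- The functionals on `ℂ^I` on which `K` acts via `τ` are the combinations of the coordinate
functionals whose index `i` satisfies `χ i = τ`. -/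
theorem coeff_bijective [Fintype I] [DecidableEq I] [Fintype J] (χ : I → K →+* ℂ) (τ : K →+* ℂ) (e : J → I) (he : Function.Injective e)
    (h : ∀ i, χ i = τ ↔ i ∈ Set.range e) (S : Submodule ℂ (Module.Dual ℂ (I → ℂ)))
    (hS : ∀ ω, ω ∈ S ↔ ∀ b p, ω (diagAct χ b p) = τ b * ω p) :
    Function.Bijective ((LinearMap.pi fun j : J =>
      (LinearMap.applyₗ (Pi.single (e j) (1 : ℂ)) : Module.Dual ℂ (I → ℂ) →ₗ[ℂ] ℂ)) ∘ₗ
        S.subtype) := by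
  constructor
  · rw [injective_iff_map_eq_zero]
    rintro ⟨ω, hω⟩ h0
    ext i
    by_cases hi : i ∈ Set.range e
    · obtain ⟨j, rfl⟩ := hi
      simpa using congrFun h0 j
    · rw [hS] at hω
      have hne : χ i ≠ τ := fun h1 => hi ((h i).1 h1)
      obtain ⟨b, hb⟩ : ∃ b, χ i b ≠ τ b := by
        by_contra hcon
        push Not at hcon
        exact hne (RingHom.ext hcon)
      have h1 := hω b (Pi.single i 1)
      have h2 : diagAct χ b (Pi.single i 1) = χ i b • Pi.single i (1 : ℂ) := by
        ext k
        rw [diagAct_apply, Pi.smul_apply, smul_eq_mul]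
        rcases eq_or_ne k i with rfl | hk
        · rfl
        · simp [hk]
      rw [h2, map_smul, smul_eq_mul, ← sub_eq_zero, ← sub_mul] at h1
      simpa using (mul_eq_zero.1 h1).resolve_left (sub_ne_zero.2 hb)
  · intro c
    refine ⟨⟨∑ j, c j • (LinearMap.proj (e j) : (I → ℂ) →ₗ[ℂ] ℂ), (hS _).2 fun b p => ?_⟩, ?_⟩
    · simp only [LinearMap.sum_apply, LinearMap.smul_apply, LinearMap.proj_apply, diagAct_apply,
        smul_eq_mul, Finset.mul_sum]
      refine Finset.sum_congr rfl fun j _ => ?_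
      rw [(h (e j)).2 ⟨j, rfl⟩]
      ring
    · ext j
      simp only [LinearMap.comp_apply, Submodule.subtype_apply, LinearMap.pi_apply,
        LinearMap.applyₗ_apply_apply, LinearMap.sum_apply, LinearMap.smul_apply,
        LinearMap.proj_apply, smul_eq_mul]
      rw [Finset.sum_eq_single j]
      · simp
      · intro k _ hk
        rw [Pi.single_eq_of_ne (fun h1 => hk (he h1)), mul_zero]
      · simp

end Coordinates

namespace Datum

variable {K : Type u} [Field K] [NumberField K] [IsCMField K]
    {V : Type v} [AddCommGroup V] [Module K V] [Module ℚ V] [IsScalarTower ℚ K V]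
    [FiniteDimensional ℚ V]

/-- The index set of the coordinates of `ℂ^g = ∏_τ ℂ^{m_τ} × ℂ^{n_τ}`. -/
abbrev Coord (D : Datum K V) : Type u := Σ τ : D.cmType, Fin (D.m τ) ⊕ Fin (D.n τ)

/-- The embedding through which `K` acts on a coordinate of `ℂ^g`: it is `τ` on `ℂ^{m_τ}` and the
conjugate of `τ` on `ℂ^{n_τ}`. -/
def coordEmb (D : Datum K V) : D.Coord → K →+* ℂ
  | ⟨τ, .inl _⟩ => τ
  | ⟨τ, .inr _⟩ => ComplexEmbedding.conjugate (τ : K →+* ℂ)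

theorem coordEmb_eq_iff (D : Datum K V) (τ : D.cmType) (i : D.Coord) :
    D.coordEmb i = τ ↔ i ∈ Set.range fun j : Fin (D.m τ) => (⟨τ, .inl j⟩ : D.Coord) := by
  obtain ⟨σ, s | s⟩ := i
  · constructor
    · intro h
      obtain rfl : σ = τ := Subtype.ext h
      exact ⟨s, rfl⟩
    · rintro ⟨j, hj⟩
      cases hj
      rfl
  · constructor
    · intro h
      have h' : ComplexEmbedding.conjugate (σ : K →+* ℂ) = τ := h
      rcases D.cmType_spec σ with ⟨-, h2⟩ | ⟨-, h2⟩
      · rw [h'] at h2; exact absurd τ.2 h2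
      · exact absurd σ.2 h2
    · rintro ⟨j, hj⟩
      cases hj

theorem coordEmb_eq_conj_iff (D : Datum K V) (τ : D.cmType) (i : D.Coord) :
    D.coordEmb i = ComplexEmbedding.conjugate (τ : K →+* ℂ) ↔
      i ∈ Set.range fun j : Fin (D.n τ) => (⟨τ, .inr j⟩ : D.Coord) := by
  obtain ⟨σ, s | s⟩ := i
  · constructor
    · intro h
      have h' : (σ : K →+* ℂ) = ComplexEmbedding.conjugate (τ : K →+* ℂ) := h
      rcases D.cmType_spec τ with ⟨-, h2⟩ | ⟨-, h2⟩
      · rw [← h'] at h2; exact absurd σ.2 h2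
      · exact absurd τ.2 h2
    · rintro ⟨j, hj⟩
      cases hj
  · constructor
    · intro h
      have h' : ComplexEmbedding.conjugate (σ : K →+* ℂ) =
        ComplexEmbedding.conjugate (τ : K →+* ℂ) := h
      obtain rfl : σ = τ := Subtype.ext (star_injective h')
      exact ⟨s, rfl⟩
    · rintro ⟨j, hj⟩
      cases hj
      rfl

/-- The period map `p_z : V → ℂ^g`. With `x = (x₁, x₂)` the coordinates of a vector at `τ`, its
components at `τ` are `x₁ - z x₂` and `ᵗz x̄₁ - x̄₂`. -/
def period (D : Datum K V) (z : D.Domain) : V →+ (D.Coord → ℂ) where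
  toFun v := fun
    | ⟨τ, .inl i⟩ => (D.frame τ v ∘ Sum.inl - z.1 τ *ᵥ (D.frame τ v ∘ Sum.inr)) i
    | ⟨τ, .inr j⟩ =>
      ((z.1 τ)ᵀ *ᵥ star (D.frame τ v ∘ Sum.inl) - star (D.frame τ v ∘ Sum.inr)) j
  map_zero' := by
    ext ⟨τ, s | s⟩ <;> simp
  map_add' v w := by
    ext ⟨τ, s | s⟩ <;> simp [Matrix.mulVec, dotProduct, mul_add, Finset.sum_add_distrib] <;> ring

/-- The components of a vector of `ℂ^g` at `τ`. -/
def fstPart (D : Datum K V) (τ : D.cmType) (p : D.Coord → ℂ) : Fin (D.m τ) → ℂ :=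
  fun i => p ⟨τ, .inl i⟩

/-- The components of a vector of `ℂ^g` at the conjugate of `τ`. -/
def sndPart (D : Datum K V) (τ : D.cmType) (p : D.Coord → ℂ) : Fin (D.n τ) → ℂ :=
  fun j => p ⟨τ, .inr j⟩

theorem period_smul (D : Datum K V) (z : D.Domain) (b : K) (v : V) :
    D.period z (b • v) = diagAct D.coordEmb b (D.period z v) := by
  ext ⟨τ, s | s⟩
  · rw [diagAct_apply]
    simp [period, coordEmb, Matrix.mulVec, dotProduct, mul_sub, Finset.mul_sum, mul_left_comm]
  · rw [diagAct_apply]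
    simp [period, coordEmb, Matrix.mulVec, dotProduct, mul_sub, Finset.mul_sum, mul_left_comm]

theorem herm_identity {m n : ℕ} {z : Matrix (Fin m) (Fin n) ℂ} (hz : InDomain z)
    (x₁ y₁ : Fin m → ℂ) (x₂ y₂ : Fin n → ℂ) :
    star y₁ ⬝ᵥ x₁ - star y₂ ⬝ᵥ x₂ =
      star (y₁ - z *ᵥ y₂) ⬝ᵥ (1 + z * (1 - zᴴ * z)⁻¹ * zᴴ) *ᵥ (x₁ - z *ᵥ x₂) -
      star (zᴴ *ᵥ y₁ - y₂) ⬝ᵥ (1 - zᴴ * z)⁻¹ *ᵥ (zᴴ *ᵥ x₁ - x₂) := by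
  have hu : IsUnit (1 - zᴴ * z).det :=
    (Matrix.isUnit_iff_isUnit_det _).1 (Matrix.PosDef.isUnit hz)
  have h1 : (1 - zᴴ * z) * (1 - zᴴ * z)⁻¹ = 1 := Matrix.mul_nonsing_inv _ hu
  have h2 : (1 - zᴴ * z)⁻¹ * (1 - zᴴ * z) = 1 := Matrix.nonsing_inv_mul _ hu
  set S := (1 - zᴴ * z)⁻¹
  have h3 : (1 + z * S * zᴴ) *ᵥ (x₁ - z *ᵥ x₂) = x₁ + z *ᵥ S *ᵥ (zᴴ *ᵥ x₁ - x₂) := by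
    have e : zᴴ *ᵥ (x₁ - z *ᵥ x₂) = (zᴴ *ᵥ x₁ - x₂) + (1 - zᴴ * z) *ᵥ x₂ := by
      rw [Matrix.mulVec_sub, Matrix.sub_mulVec, Matrix.one_mulVec, Matrix.mulVec_mulVec]
      abel
    rw [Matrix.add_mulVec, Matrix.one_mulVec, ← Matrix.mulVec_mulVec, ← Matrix.mulVec_mulVec, e,
      Matrix.mulVec_add, Matrix.mulVec_add, Matrix.mulVec_mulVec x₂ S, h2, Matrix.one_mulVec]
    abel
  have h4 : zᴴ *ᵥ z *ᵥ S *ᵥ (zᴴ *ᵥ x₁ - x₂) =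
      S *ᵥ (zᴴ *ᵥ x₁ - x₂) - (zᴴ *ᵥ x₁ - x₂) := by
    have e := congrArg (fun M => M *ᵥ (zᴴ *ᵥ x₁ - x₂)) h1
    simp only [Matrix.sub_mul, Matrix.one_mul, Matrix.sub_mulVec, Matrix.one_mulVec] at e
    rw [Matrix.mulVec_mulVec, Matrix.mulVec_mulVec, eq_sub_iff_add_eq]
    exact (sub_eq_iff_eq_add'.1 e).symm
  have h5 : ∀ (u : Fin n → ℂ) (w : Fin m → ℂ), star (z *ᵥ u) ⬝ᵥ w = star u ⬝ᵥ zᴴ *ᵥ w := by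
    intro u w
    rw [Matrix.star_mulVec, ← Matrix.dotProduct_mulVec]
  have h6 : ∀ (u : Fin m → ℂ) (w : Fin n → ℂ), star (zᴴ *ᵥ u) ⬝ᵥ w = star u ⬝ᵥ z *ᵥ w := by
    intro u w
    rw [Matrix.star_mulVec, Matrix.conjTranspose_conjTranspose, ← Matrix.dotProduct_mulVec]
  rw [h3, star_sub, star_sub, sub_dotProduct, sub_dotProduct, h5, h6, Matrix.mulVec_add, h4,
    dotProduct_add, dotProduct_add, dotProduct_sub (star y₂) (S *ᵥ _), dotProduct_sub (star y₂)]
  ring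

theorem period_herm (D : Datum K V) (z : D.Domain) (τ : D.cmType) (v w : V) :
    (τ : K →+* ℂ) (D.herm v w) =
      star (D.fstPart τ (D.period z w)) ⬝ᵥ
        (1 + z.1 τ * (1 - (z.1 τ)ᴴ * z.1 τ)⁻¹ * (z.1 τ)ᴴ) *ᵥ D.fstPart τ (D.period z v) -
      D.sndPart τ (D.period z w) ⬝ᵥ
        (1 - (z.1 τ)ᴴ * z.1 τ)⁻¹ *ᵥ star (D.sndPart τ (D.period z v)) := by
  have h1 := D.frame_herm τ v w
  have e1 : D.fstPart τ (D.period z v) =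
    D.frame τ v ∘ Sum.inl - z.1 τ *ᵥ (D.frame τ v ∘ Sum.inr) := rfl
  have e2 : D.fstPart τ (D.period z w) =
    D.frame τ w ∘ Sum.inl - z.1 τ *ᵥ (D.frame τ w ∘ Sum.inr) := rfl
  have e0 : ∀ u, D.sndPart τ (D.period z u) =
      star ((z.1 τ)ᴴ *ᵥ (D.frame τ u ∘ Sum.inl) - D.frame τ u ∘ Sum.inr) := by
    intro u
    have : D.sndPart τ (D.period z u) =
      (z.1 τ)ᵀ *ᵥ star (D.frame τ u ∘ Sum.inl) - star (D.frame τ u ∘ Sum.inr) := rfl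
    rw [this, star_sub, Matrix.star_mulVec, Matrix.conjTranspose_conjTranspose,
      Matrix.mulVec_transpose]
  rw [e1, e2, e0, e0, star_star, ← herm_identity (z.2 τ), h1]
  have h2 : ∀ u, D.frame τ u = Sum.elim (D.frame τ u ∘ Sum.inl) (D.frame τ u ∘ Sum.inr) :=
    fun u => (Sum.elim_comp_inl_inr _).symm
  simp [dotProduct, Fintype.sum_sum_type, signMat, Matrix.mulVec, Matrix.one_apply,
    sub_eq_add_neg]

theorem trace_eq_sum (D : Datum K V) (x : K) :
    ((Algebra.trace ℚ K x : ℚ) : ℝ) = ∑ τ : D.cmType, 2 * ((τ : K →+* ℂ) x).re := by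
  have h1 : ((Algebra.trace ℚ K x : ℚ) : ℂ) = ∑ σ : K →+* ℂ, σ x := by
    rw [← eq_ratCast (algebraMap ℚ ℂ), trace_eq_sum_embeddings ℂ]
    exact (Fintype.sum_equiv (RingHom.equivRatAlgHom K ℂ) _ _ fun _ => rfl).symm
  classical
  have h2 : ∑ σ : K →+* ℂ, σ x = ∑ σ ∈ D.cmType, (σ x + conj (σ x)) := by
    rw [Finset.sum_add_distrib, ← Finset.sum_add_sum_compl D.cmType]
    congr 1
    have hc : ∀ σ : K →+* ℂ,
        ComplexEmbedding.conjugate (ComplexEmbedding.conjugate σ) = σ := fun σ => by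
      ext; simp
    refine Finset.sum_bij' (fun σ _ => ComplexEmbedding.conjugate σ)
      (fun σ _ => ComplexEmbedding.conjugate σ) ?_ ?_ (fun σ _ => hc σ) (fun σ _ => hc σ) ?_
    · intro σ hσ
      rcases D.cmType_spec σ with ⟨h, -⟩ | ⟨h, -⟩
      · exact absurd h (Finset.mem_compl.1 hσ)
      · exact h
    · intro σ hσ
      rw [Finset.mem_compl]
      rcases D.cmType_spec σ with ⟨-, h⟩ | ⟨-, h⟩
      · exact h
      · exact absurd hσ h
    · intro σ _
      simp
  rw [h2, ← Finset.sum_coe_sort] at h1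
  have h3 := congrArg Complex.re h1
  rw [Complex.ratCast_re, Complex.re_sum] at h3
  rw [h3]
  refine Finset.sum_congr rfl fun τ _ => ?_
  simp
  ring

/-- The Riemann form on `ℂ^g` that corresponds to `psi` under `p_z`. -/
def riemann (D : Datum K V) (z : D.Domain) :
    (D.Coord → ℂ) →ₗ[ℝ] (D.Coord → ℂ) →ₗ[ℝ] ℝ :=
  LinearMap.mk₂ ℝ (fun p q => ∑ τ : D.cmType, 2 * ((τ : K →+* ℂ) D.α *
      (star (D.fstPart τ q) ⬝ᵥ
        (1 + z.1 τ * (1 - (z.1 τ)ᴴ * z.1 τ)⁻¹ * (z.1 τ)ᴴ) *ᵥ D.fstPart τ p -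
      D.sndPart τ q ⬝ᵥ (1 - (z.1 τ)ᴴ * z.1 τ)⁻¹ *ᵥ star (D.sndPart τ p))).re)
    (fun p p' q => by
      rw [← Finset.sum_add_distrib]
      refine Finset.sum_congr rfl fun τ _ => ?_
      have e1 : D.fstPart τ (p + p') = D.fstPart τ p + D.fstPart τ p' := rfl
      have e2 : D.sndPart τ (p + p') = D.sndPart τ p + D.sndPart τ p' := rfl
      rw [e1, e2, star_add, Matrix.mulVec_add, Matrix.mulVec_add, dotProduct_add, dotProduct_add,
        ← mul_add, ← Complex.add_re]
      ring_nf)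
    (fun c p q => by
      rw [smul_eq_mul, Finset.mul_sum]
      refine Finset.sum_congr rfl fun τ _ => ?_
      have e1 : D.fstPart τ (c • p) = (c : ℂ) • D.fstPart τ p := by
        ext; simp [fstPart]
      have e2 : D.sndPart τ (c • p) = (c : ℂ) • D.sndPart τ p := by
        ext; simp [sndPart]
      rw [e1, e2, star_smul, Matrix.mulVec_smul, Matrix.mulVec_smul, dotProduct_smul,
        dotProduct_smul, Complex.star_def, Complex.conj_ofReal, ← smul_sub, smul_eq_mul,
        mul_left_comm, Complex.re_ofReal_mul]
      ring)
    (fun p q q' => by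
      rw [← Finset.sum_add_distrib]
      refine Finset.sum_congr rfl fun τ _ => ?_
      have e1 : D.fstPart τ (q + q') = D.fstPart τ q + D.fstPart τ q' := rfl
      have e2 : D.sndPart τ (q + q') = D.sndPart τ q + D.sndPart τ q' := rfl
      rw [e1, e2, star_add, add_dotProduct, add_dotProduct, ← mul_add, ← Complex.add_re]
      ring_nf)
    (fun c p q => by
      rw [smul_eq_mul, Finset.mul_sum]
      refine Finset.sum_congr rfl fun τ _ => ?_
      have e1 : D.fstPart τ (c • q) = (c : ℂ) • D.fstPart τ q := by
        ext; simp [fstPart]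
      have e2 : D.sndPart τ (c • q) = (c : ℂ) • D.sndPart τ q := by
        ext; simp [sndPart]
      rw [e1, e2, star_smul, smul_dotProduct, smul_dotProduct, Complex.star_def,
        Complex.conj_ofReal, ← smul_sub, smul_eq_mul, mul_left_comm, Complex.re_ofReal_mul]
      ring)

theorem riemann_period (D : Datum K V) (z : D.Domain) (v w : V) :
    D.riemann z (D.period z v) (D.period z w) = D.psi v w := by
  rw [psi, LinearMap.mk₂_apply, D.trace_eq_sum, riemann, LinearMap.mk₂_apply]
  refine Finset.sum_congr rfl fun τ _ => ?_
  rw [map_mul, D.period_herm z]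

theorem riemann_I (D : Datum K V) (z : D.Domain) (p q : D.Coord → ℂ) :
    D.riemann z (Complex.I • p) (Complex.I • q) = D.riemann z p q := by
  rw [riemann, LinearMap.mk₂_apply, LinearMap.mk₂_apply]
  refine Finset.sum_congr rfl fun τ _ => ?_
  have e1 : ∀ p, D.fstPart τ (Complex.I • p) = Complex.I • D.fstPart τ p := fun _ => rfl
  have e2 : ∀ p, D.sndPart τ (Complex.I • p) = Complex.I • D.sndPart τ p := fun _ => rfl
  simp only [e1, e2, star_smul, Matrix.mulVec_smul, smul_dotProduct, dotProduct_smul, smul_smul,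
    Complex.star_def, Complex.conj_I, neg_mul, mul_neg, Complex.I_mul_I, neg_neg, one_smul]

theorem riemann_pos (D : Datum K V) (z : D.Domain) {p : D.Coord → ℂ} (hp : p ≠ 0) :
    0 < D.riemann z p (Complex.I • p) := by
  rw [riemann, LinearMap.mk₂_apply]
  have hI : ∀ τ : D.cmType, (τ : K →+* ℂ) D.α = (((τ : K →+* ℂ) D.α).im : ℂ) * Complex.I := by
    intro τ
    have h := congrArg (τ : K →+* ℂ) D.α_conj
    rw [IsCMField.complexEmbedding_complexConj, map_neg] at h
    have h' := congrArg Complex.re h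
    rw [Complex.conj_re, Complex.neg_re] at h'
    apply Complex.ext
    · simp; linarith
    · simp
  have hS : ∀ τ : D.cmType, ((1 - (z.1 τ)ᴴ * z.1 τ)⁻¹).PosDef := fun τ =>
    Matrix.PosDef.inv (z.2 τ)
  have hP : ∀ τ : D.cmType,
      (1 + z.1 τ * (1 - (z.1 τ)ᴴ * z.1 τ)⁻¹ * (z.1 τ)ᴴ).PosDef := fun τ => (z.2 τ).swap.1
  have hterm : ∀ τ : D.cmType, 2 * ((τ : K →+* ℂ) D.α *
      (star (D.fstPart τ (Complex.I • p)) ⬝ᵥ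
        (1 + z.1 τ * (1 - (z.1 τ)ᴴ * z.1 τ)⁻¹ * (z.1 τ)ᴴ) *ᵥ D.fstPart τ p -
      D.sndPart τ (Complex.I • p) ⬝ᵥ
        (1 - (z.1 τ)ᴴ * z.1 τ)⁻¹ *ᵥ star (D.sndPart τ p))).re =
      2 * ((τ : K →+* ℂ) D.α).im *
        ((star (D.fstPart τ p) ⬝ᵥ
          (1 + z.1 τ * (1 - (z.1 τ)ᴴ * z.1 τ)⁻¹ * (z.1 τ)ᴴ) *ᵥ D.fstPart τ p).re +
        (star (star (D.sndPart τ p)) ⬝ᵥ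
          (1 - (z.1 τ)ᴴ * z.1 τ)⁻¹ *ᵥ star (D.sndPart τ p)).re) := by
    intro τ
    have e1 : D.fstPart τ (Complex.I • p) = Complex.I • D.fstPart τ p := rfl
    have e2 : D.sndPart τ (Complex.I • p) = Complex.I • D.sndPart τ p := rfl
    rw [e1, e2, star_smul, smul_dotProduct, smul_dotProduct, hI τ, star_star]
    generalize star (D.fstPart τ p) ⬝ᵥ _ = A
    generalize D.sndPart τ p ⬝ᵥ _ = B
    simp
    ring
  have h1 : ∀ τ : D.cmType, 0 ≤ (star (D.fstPart τ p) ⬝ᵥ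
      (1 + z.1 τ * (1 - (z.1 τ)ᴴ * z.1 τ)⁻¹ * (z.1 τ)ᴴ) *ᵥ D.fstPart τ p).re := fun τ =>
    (Complex.le_def.1 ((hP τ).posSemidef.dotProduct_mulVec_nonneg (D.fstPart τ p))).1
  have h2 : ∀ τ : D.cmType, 0 ≤ (star (star (D.sndPart τ p)) ⬝ᵥ
      (1 - (z.1 τ)ᴴ * z.1 τ)⁻¹ *ᵥ star (D.sndPart τ p)).re := fun τ =>
    (Complex.le_def.1 ((hS τ).posSemidef.dotProduct_mulVec_nonneg (star (D.sndPart τ p)))).1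
  have h3 : ∀ τ : D.cmType, 0 < 2 * ((τ : K →+* ℂ) D.α).im := fun τ =>
    mul_pos two_pos (D.α_pos _ τ.2)
  obtain ⟨⟨τ, s⟩, hs⟩ := Function.ne_iff.1 hp
  refine Finset.sum_pos' (fun τ _ => ?_) ⟨τ, Finset.mem_univ _, ?_⟩
  · rw [hterm]
    exact mul_nonneg (h3 τ).le (add_nonneg (h1 τ) (h2 τ))
  · rw [hterm]
    refine mul_pos (h3 τ) ?_
    rcases s with s | s
    · have hne : D.fstPart τ p ≠ 0 := fun h => hs (congrFun h s)
      exact add_pos_of_pos_of_nonneg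
        (Complex.lt_def.1 ((hP τ).dotProduct_mulVec_pos hne)).1 (h2 τ)
    · have hne : star (D.sndPart τ p) ≠ 0 := fun h => hs (congrFun (star_eq_zero.1 h) s)
      exact add_pos_of_nonneg_of_pos (h1 τ)
        (Complex.lt_def.1 ((hS τ).dotProduct_mulVec_pos hne)).1

theorem psi_alt (D : Datum K V) (v : V) : D.psi v v = 0 := by
  have h : ((D.psi v v : ℚ) : ℝ) = 0 := by
    rw [psi, LinearMap.mk₂_apply, D.trace_eq_sum]
    refine Finset.sum_eq_zero fun τ _ => ?_
    have h1 : IsCMField.complexConj K (D.α * D.herm v v) = -(D.α * D.herm v v) := by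
      rw [map_mul, D.herm_conj, D.α_conj, neg_mul]
    have h2 := congrArg (fun x => ((τ : K →+* ℂ) x).re) h1
    simp only [IsCMField.complexEmbedding_complexConj, map_neg, Complex.conj_re,
      Complex.neg_re] at h2
    linarith
  exact_mod_cast h

theorem psi_smul (D : Datum K V) (b : K) (v w : V) :
    D.psi (b • v) w = D.psi v (IsCMField.complexConj K b • w) := by
  rw [psi, LinearMap.mk₂_apply, LinearMap.mk₂_apply, map_smul, Pi.smul_apply, herm_smul_right,
    smul_eq_mul, IsCMField.complexConj_apply_apply]

theorem psi_nondegenerate (D : Datum K V) (v : V) (h : ∀ w, D.psi v w = 0) : v = 0 := by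
  refine D.herm_nondegenerate v fun w => ?_
  have key : ∀ b : K, Algebra.traceForm ℚ K (D.α * D.herm v w) b = 0 := by
    intro b
    have := h (IsCMField.complexConj K b • w)
    rw [psi, LinearMap.mk₂_apply, herm_smul_right, IsCMField.complexConj_apply_apply] at this
    rw [Algebra.traceForm_apply, ← this]
    congr 1
    ring
  exact (mul_eq_zero.1 ((traceForm_nondegenerate ℚ K).1 _ key)).resolve_left D.α_ne_zero

theorem finrank_eq (D : Datum K V) : finrank ℚ V = finrank ℝ (D.Coord → ℂ) := by
  have h1 : (finrank ℚ K : ℝ) = 2 * Fintype.card D.cmType := by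
    have := D.trace_eq_sum 1
    simp only [map_one, Complex.one_re] at this
    rw [← map_one (algebraMap ℚ K), Algebra.trace_algebraMap] at this
    simpa [mul_comm] using this
  have h2 : finrank ℚ K = 2 * Fintype.card D.cmType := by exact_mod_cast h1
  have := finite_of_rat K V
  rw [← Module.finrank_mul_finrank ℚ K V, h2, finrank_real_of_complex,
    Module.finrank_fintype_fun_eq_card, Fintype.card_sigma]
  simp [D.frame_rank, mul_assoc]

theorem period_span (D : Datum K V) (z : D.Domain) :
    Submodule.span ℝ (Set.range (D.period z)) = ⊤ := by
  let b := Module.finBasis ℚ V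
  have hli : LinearIndependent ℝ (fun i => D.period z (b i)) := by
    rw [Fintype.linearIndependent_iff]
    intro c hc
    have hG : ((LinearMap.BilinForm.toMatrix b D.psi).map (algebraMap ℚ ℝ)).det ≠ 0 := by
      rw [← RingHom.mapMatrix_apply, ← RingHom.map_det]
      refine (map_ne_zero _).2 ?_
      rw [← LinearMap.BilinForm.nondegenerate_iff_det_ne_zero]
      refine ⟨fun v hv => D.psi_nondegenerate v hv, fun v hv => D.psi_nondegenerate v fun w => ?_⟩
      have halt : LinearMap.IsAlt D.psi := D.psi_alt
      rw [← halt.neg, hv, neg_zero]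
    have h0 : c ᵥ* ((LinearMap.BilinForm.toMatrix b D.psi).map (algebraMap ℚ ℝ)) = 0 := by
      ext j
      have := congrArg (fun p => D.riemann z p (D.period z (b j))) hc
      simp only [map_sum, map_smul, LinearMap.sum_apply, LinearMap.smul_apply, map_zero,
        LinearMap.zero_apply, D.riemann_period] at this
      simpa [Matrix.vecMul, dotProduct, LinearMap.BilinForm.toMatrix_apply] using this
    exact congrFun (Matrix.eq_zero_of_vecMul_eq_zero hG h0)
  rw [eq_top_iff, ← hli.span_eq_top_of_card_eq_finrank' (by simp [D.finrank_eq])]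
  refine Submodule.span_mono ?_
  rintro _ ⟨i, rfl⟩
  exact ⟨b i, rfl⟩

theorem finrank_eigen_fst (D : Datum K V) (τ : D.cmType) :
    finrank ℂ (⨅ b : K, Module.End.eigenspace (diagAct D.coordEmb b) ((τ : K →+* ℂ) b) :
      Submodule ℂ (D.Coord → ℂ)) = D.m τ := by
  rw [finrank_eigen D.coordEmb τ (fun j : Fin (D.m τ) => (⟨τ, .inl j⟩ : D.Coord))
    (fun a b h => by simpa using h) (D.coordEmb_eq_iff τ), Fintype.card_fin]

theorem finrank_eigen_snd (D : Datum K V) (τ : D.cmType) :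
    finrank ℂ (⨅ b : K, Module.End.eigenspace (diagAct D.coordEmb b)
      (ComplexEmbedding.conjugate (τ : K →+* ℂ) b) : Submodule ℂ (D.Coord → ℂ)) = D.n τ := by
  rw [finrank_eigen D.coordEmb _ (fun j : Fin (D.n τ) => (⟨τ, .inr j⟩ : D.Coord))
    (fun a b h => by simpa using h) (D.coordEmb_eq_conj_iff τ), Fintype.card_fin]

/-- The PEL variety `A_z = ℂ^g / p_z(L)`, with the polarization given by `psi`, with the action of
`K` induced by that on `V`, and with the level structure given by the identity of `V`. -/
def variety (D : Datum K V) (𝒦 : Subgroup (AdelicGL V)) (z : D.Domain) : PELVariety D 𝒦 where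
  H1 := V
  Lie := D.Coord → ℂ
  lattice := D.L
  lattice_fg := D.L_fg
  lattice_span := D.L_span
  per := D.period z
  per_finrank := D.finrank_eq
  per_span := D.period_span z
  pol := D.psi
  pol_alt := D.psi_alt
  pol_integral := D.L_integral
  pol_riemann := ⟨D.riemann z, D.riemann_period z, D.riemann_I z, fun _ hp => D.riemann_pos z hp⟩
  ι := (Algebra.lsmul ℚ ℚ V : K →ₐ[ℚ] Module.End ℚ V).toRingHom.prod (diagAct D.coordEmb)
  ι_per := D.period_smul z
  rosati := D.psi_smul
  level := {k | k ∈ 𝒦}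
  level_spec := ⟨LinearEquiv.refl _ _, fun _ _ => rfl, ⟨1, fun x y => by simp [psiAdelic]⟩, by
    ext k
    constructor
    · intro hk
      exact ⟨k, hk, rfl⟩
    · rintro ⟨k', hk', rfl⟩
      exact hk'⟩
  kottwitz τ := ⟨D.finrank_eigen_fst τ, D.finrank_eigen_snd τ⟩

open Classical in
/-- The element `ℓ_z ∈ ℰ_{A_z}` given by the coordinates of `ℂ^g`: it sends an invariant
differential `∑ c_j dw_j` to its coefficients `(c_j)_j`. -/
def frameAt (D : Datum K V) (𝒦 : Subgroup (AdelicGL V)) (z : D.Domain) :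
    (D.variety 𝒦 z).Frames := fun τ =>
  (LinearEquiv.ofBijective
    ((LinearMap.pi fun j : Fin (D.m τ) =>
      (LinearMap.applyₗ (Pi.single (⟨τ, .inl j⟩ : D.Coord) (1 : ℂ)) :
        Module.Dual ℂ (D.Coord → ℂ) →ₗ[ℂ] ℂ)) ∘ₗ ((D.variety 𝒦 z).Omega τ).subtype)
    (coeff_bijective D.coordEmb τ _ (fun a b h => by simpa using h) (D.coordEmb_eq_iff τ) _
      fun _ => Iff.rfl),
   LinearEquiv.ofBijective
    ((LinearMap.pi fun j : Fin (D.n τ) =>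
      (LinearMap.applyₗ (Pi.single (⟨τ, .inr j⟩ : D.Coord) (1 : ℂ)) :
        Module.Dual ℂ (D.Coord → ℂ) →ₗ[ℂ] ℂ)) ∘ₗ
      ((D.variety 𝒦 z).Omega (ComplexEmbedding.conjugate (τ : K →+* ℂ))).subtype)
    (coeff_bijective D.coordEmb _ _ (fun a b h => by simpa using h) (D.coordEmb_eq_conj_iff τ) _
      fun _ => Iff.rfl))

/-- `A` is parametrized by `Γ \ 𝓗`: it is equivalent to some `A_z`. -/
def IsParametrized (D : Datum K V) (𝒦 : Subgroup (AdelicGL V)) (A : PELVariety D 𝒦) : Prop :=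
  ∃ z, Nonempty ((D.variety 𝒦 z).Isogeny A)

theorem isParametrized_variety (D : Datum K V) (𝒦 : Subgroup (AdelicGL V)) (z : D.Domain) :
    D.IsParametrized 𝒦 (D.variety 𝒦 z) :=
  ⟨z, ⟨{ onH1 := LinearEquiv.refl _ _
         onLie := LinearEquiv.refl _ _
         per_comm := fun _ => rfl
         pol := ⟨1, one_ne_zero, fun x y => by simp⟩
         ι_H1 := fun _ _ => rfl
         ι_Lie := fun _ _ => rfl
         level := by
          have h : (LinearEquiv.refl ℚ V).baseChange ℚ FinAdele V V =
              LinearEquiv.refl FinAdele _ := (toAdelic (K := K) (V := V)).map_one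
          ext η
          constructor
          · intro hη
            exact ⟨η, hη, by erw [h]; rfl⟩
          · rintro ⟨η', hη', rfl⟩
            erw [h]; exact hη' }⟩⟩

/-- The pairs `(A, ℓ)` with `A` parametrized by `Γ \ 𝓗` and `ℓ ∈ ℰ_A`. -/
def Pair (D : Datum K V) (𝒦 : Subgroup (AdelicGL V)) : Type (max (u + 1) (v + 1)) :=
  Σ A : {A : PELVariety D 𝒦 // D.IsParametrized 𝒦 A}, A.1.Frames

/-- Two pairs are equivalent if there is an isogeny of PEL varieties under which the elements of
`ℰ` correspond. -/
def Pair.Equivalent {D : Datum K V} {𝒦 : Subgroup (AdelicGL V)} (P Q : D.Pair 𝒦) : Prop :=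
  ∃ φ : P.1.1.Isogeny Q.1.1, ∀ τ : D.cmType,
    (∀ ω, (Q.2 τ).1 ω = (P.2 τ).1 (φ.pullback _ ω)) ∧
      ∀ ω, (Q.2 τ).2 ω = (P.2 τ).2 (φ.pullback _ ω)

/-- The pair `(A_z, ℓ_z)`. -/
def pairAt (D : Datum K V) (𝒦 : Subgroup (AdelicGL V)) (z : D.Domain) : D.Pair 𝒦 :=
  ⟨⟨D.variety 𝒦 z, D.isParametrized_variety 𝒦 z⟩, D.frameAt 𝒦 z⟩

section Functions

variable {X : Type w} [AddCommGroup X] [Module ℂ X]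

/-- Functions of (equivalence classes of) pairs `(A, ℓ)` such that
`F(A, g ℓ) = ρ(ᵗg)⁻¹ F(A, ℓ)`. -/
structure IsPairFunction (D : Datum K V) (𝒦 : Subgroup (AdelicGL V))
    (ρ : Representation ℂ D.H X) (F : D.Pair 𝒦 → X) : Prop where
  equivalent : ∀ P Q : D.Pair 𝒦, P.Equivalent Q → F P = F Q
  smul : ∀ (A : {A : PELVariety D 𝒦 // D.IsParametrized 𝒦 A}) (l : A.1.Frames) (g : D.H),
    F ⟨A, l.smul g⟩ = ρ (transpose g)⁻¹ (F ⟨A, l⟩)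

end Functions

end Datum

end

end UnitaryPEL

/-!
The correspondence rests on one computation. A quasi-isogeny `φ : A_z → A_{z'}` of PEL varieties
acts on rational homology `V` by a `K`-linear similitude `γ` of `psi`. The Riemann forms are
positive definite, so the similitude factor is positive, and the level structures force
`γ ∈ 𝒦`; hence `γ ∈ Γ` (`exists_mem_Gamma`). Since `𝒦` is compact, the values `⟨γᵏ x, γᵏ y⟩`,
`k ∈ ℤ`, are bounded at every prime, so the factor is a positive rational unit everywhere and
equals `1` (`psi_Gamma`).

On Lie algebras `φ` commutes with `K`, so it is block diagonal along the CM type. Write the two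
components of `p_z` at `τ` as the linear form `(1, -z)` and the conjugate of `(ᵗz̄, -1)`. Comparing
periods, the blocks `N`, `N'` satisfy `N (1, -z) = (1, -z') γ` and
`N̄' (ᵗz̄, -1) = (ᵗz̄', -1) γ`. The first equation forces `z' = γ z` (`eq_act_of_period`), and the
unitarity of `γ` identifies the transposed blocks with the inverses of `λ(γ, z)` and `μ(γ, z)`
(`lam_transpose_mul`, `mu_conjTranspose_mul`). Thus `ℓ_z(φ^* ω) = M_γ(z)⁻¹ ℓ_{γ z}(ω)`
(`relates_frameAt`). Conversely every `γ ∈ Γ` comes from an isogeny `A_z → A_{γ z}`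
(`isogenyOfGamma`), and the equivariance of `F` turns this relation into the automorphy of `f_F`.

For the inverse map, a pair `(A, ℓ)` with an isogeny `φ : A_z → A` has a unique `h ∈ H(ℂ)` with
`ℓ_z(φ^* ω) = h ℓ(ω)`, and equivariance leaves only the value `F(A, ℓ) = ρ(h)⁻¹ f(z)`. Two choices
of `(z, φ)` differ by an isogeny `A_z → A_{z'}`, so the computation above together with the
automorphy of `f` shows that the value is well defined (`IsValueAt.unique`).
-/

namespace UnitaryPEL

open scoped TensorProduct Matrix ComplexConjugate ComplexOrder
open NumberField Module

universe u v w

noncomputable section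

/-! ### The similitude factor of an element of `Γ` -/

section SimilitudeFactor

open IsDedekindDomain

/-- A compact subset of a completion of `ℚ` is bounded. -/
theorem exists_valuation_le_of_isCompact (v : HeightOneSpectrum ℤ) {S : Set (v.adicCompletion ℚ)}
    (hS : IsCompact S) : ∃ c : (WithZero (Multiplicative ℤ)), ∀ x ∈ S, Valued.v x ≤ c := by
  -- The closed balls of nonzero radius `|y|` are open and cover the completion.
  have hU : ∀ y : {y : v.adicCompletion ℚ // y ≠ 0},
      IsOpen {x : v.adicCompletion ℚ | Valued.v x ≤ Valued.v y.1} := fun y => by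
    have := Valued.isOpen_closedBall (v.adicCompletion ℚ)
      (r := Valued.v.restrict y.1) (by simpa using y.2)
    simpa [Valuation.restrict_le_iff] using this
  have : Nonempty {y : v.adicCompletion ℚ // y ≠ 0} := ⟨⟨1, one_ne_zero⟩⟩
  obtain ⟨y, hy⟩ := hS.elim_directed_cover _ hU
    (fun x _ => by
      rw [Set.mem_iUnion]
      by_cases hx : x = 0
      · exact ⟨⟨1, one_ne_zero⟩, by simp [hx]⟩
      · exact ⟨⟨x, hx⟩, le_refl (Valued.v x)⟩)
    (fun y y' => by
      rcases le_total (Valued.v y.1) (Valued.v y'.1) with h | h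
      · exact ⟨y', fun x hx => le_trans hx h, fun x hx => hx⟩
      · exact ⟨y, fun x hx => hx, fun x hx => le_trans hx h⟩)
  exact ⟨_, fun x hx => hy hx⟩

theorem le_one_of_pow_mul_le {a b c : WithZero (Multiplicative ℤ)} (hb : b ≠ 0)
    (h : ∀ k : ℕ, a ^ k * b ≤ c) : a ≤ 1 := by
  by_contra ha
  push Not at ha
  obtain ⟨k, hk⟩ := MulArchimedean.arch (c / b) ha
  have h1 := h (k + 1)
  rw [← le_div_iff₀ (zero_lt_iff.2 hb)] at h1
  exact absurd (h1.trans hk) (not_le.2 (pow_lt_pow_right₀ ha (Nat.lt_succ_self k)))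

theorem exists_int_of_valuation_le_one {r : ℚ}
    (h : ∀ v : HeightOneSpectrum ℤ, v.valuation ℚ r ≤ 1) : ∃ k : ℤ, (k : ℚ) = r := by
  obtain ⟨k, hk⟩ := HeightOneSpectrum.mem_integers_of_valuation_le_one (R := ℤ) ℚ r h
  exact ⟨k, by simpa using hk⟩

theorem rat_eq_one_of_valuation_le_one {r : ℚ} (hr : 0 < r)
    (h : ∀ v : HeightOneSpectrum ℤ, v.valuation ℚ r ≤ 1)
    (h' : ∀ v : HeightOneSpectrum ℤ, v.valuation ℚ r⁻¹ ≤ 1) : r = 1 := by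
  obtain ⟨k, rfl⟩ := exists_int_of_valuation_le_one h
  obtain ⟨l, hl⟩ := exists_int_of_valuation_le_one h'
  have hk : 0 < k := by exact_mod_cast hr
  have h1 : k * l = 1 := by
    have : (k : ℚ) * l = 1 := by rw [hl, mul_inv_cancel₀ hr.ne']
    exact_mod_cast this
  rcases Int.eq_one_or_neg_one_of_mul_eq_one h1 with h2 | h2
  · simp [h2]
  · omega

end SimilitudeFactor

namespace Datum

variable {K : Type u} [Field K] [NumberField K] [IsCMField K]
    {V : Type v} [AddCommGroup V] [Module K V] [Module ℚ V] [IsScalarTower ℚ K V]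
    [FiniteDimensional ℚ V]

theorem continuous_psiAdelic_apply (D : Datum K V) (x y : FinAdele ⊗[ℚ] V) :
    @Continuous _ _ (adelicTopology V) _ fun g : AdelicGL V => D.psiAdelic (g x) (g y) := by
  let : TopologicalSpace (Module.End FinAdele (FinAdele ⊗[ℚ] V)) :=
    moduleTopology FinAdele (Module.End FinAdele (FinAdele ⊗[ℚ] V))
  have : IsModuleTopology FinAdele (Module.End FinAdele (FinAdele ⊗[ℚ] V)) := ⟨rfl⟩
  let : TopologicalSpace (AdelicGL V) := adelicTopology V
  have : ContinuousAdd (Module.End FinAdele (FinAdele ⊗[ℚ] V)) :=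
    ModuleTopology.continuousAdd _ _
  obtain ⟨B, hB⟩ : ∃ B : Module.End FinAdele (FinAdele ⊗[ℚ] V) →ₗ[FinAdele]
      Module.End FinAdele (FinAdele ⊗[ℚ] V) →ₗ[FinAdele] FinAdele,
      ∀ a b, B a b = D.psiAdelic (a x) (b y) :=
    ⟨D.psiAdelic.compl₁₂ (LinearMap.applyₗ x) (LinearMap.applyₗ y), fun _ _ => rfl⟩
  have hBc : Continuous fun ab : Module.End FinAdele (FinAdele ⊗[ℚ] V) ×
      Module.End FinAdele (FinAdele ⊗[ℚ] V) => B ab.1 ab.2 :=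
    IsModuleTopology.continuous_bilinear_of_finite_left (R := FinAdele) (C := FinAdele)
      (A := Module.End FinAdele (FinAdele ⊗[ℚ] V)) (B := Module.End FinAdele (FinAdele ⊗[ℚ] V)) B
  have h1 : Continuous fun g : AdelicGL V => g.toLinearMap :=
    continuous_fst.comp (continuous_induced_dom
      (f := fun g : AdelicGL V => (g.toLinearMap, g.symm.toLinearMap)))
  have h2 := hBc.comp (h1.prodMk h1)
  have h3 : (fun g : AdelicGL V => D.psiAdelic (g x) (g y)) =
      (fun ab : Module.End FinAdele (FinAdele ⊗[ℚ] V) × Module.End FinAdele (FinAdele ⊗[ℚ] V) =>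
        B ab.1 ab.2) ∘ fun g : AdelicGL V => (g.toLinearMap, g.toLinearMap) :=
    funext fun g => (hB g.toLinearMap g.toLinearMap).symm
  rw [h3]
  exact h2

theorem evalPlace_psiAdelic_tmul (D : Datum K V) (v : IsDedekindDomain.HeightOneSpectrum ℤ)
    (x y : V) :
    evalPlace v (D.psiAdelic (1 ⊗ₜ x) (1 ⊗ₜ y)) =
      algebraMap ℚ (v.adicCompletion ℚ) (D.psi x y) := by
  rw [psiAdelic, LinearMap.BilinForm.baseChange_tmul, mul_one, ← Algebra.algebraMap_eq_smul_one]
  rfl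

theorem toAdelic_tmul (g : V ≃ₗ[K] V) (a : FinAdele) (x : V) :
    toAdelic g (a ⊗ₜ x) = a ⊗ₜ g x := rfl

theorem psi_pow_apply (D : Datum K V) {g : V ≃ₗ[K] V} {r : ℚ}
    (h : ∀ x y, D.psi (g x) (g y) = r * D.psi x y) (k : ℕ) (x y : V) :
    D.psi ((g ^ k) x) ((g ^ k) y) = r ^ k * D.psi x y := by
  induction k with
  | zero => simp
  | succ k ih => rw [pow_succ', LinearEquiv.mul_apply, LinearEquiv.mul_apply, h, ih]; ring

/-- The values `⟨g x, g y⟩`, for `g` in a compact group, are bounded at each prime, so the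
similitude factor of an element of the group has no pole there. -/
theorem valuation_similitude_le_one (D : Datum K V) {𝒦 : Subgroup (AdelicGL V)}
    (h𝒦 : @IsCompact _ (adelicTopology V) (𝒦 : Set (AdelicGL V))) {g : V ≃ₗ[K] V} {r : ℚ}
    (h : ∀ x y, D.psi (g x) (g y) = r * D.psi x y) (hg : toAdelic g ∈ 𝒦) {x y : V}
    (hxy : D.psi x y ≠ 0) (v : IsDedekindDomain.HeightOneSpectrum ℤ) : v.valuation ℚ r ≤ 1 := by
  let : TopologicalSpace (AdelicGL V) := adelicTopology V
  have hev : Continuous (evalPlace v) := RestrictedProduct.continuous_eval v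
  have hc : Continuous fun g : AdelicGL V =>
      evalPlace v (D.psiAdelic (g (1 ⊗ₜ x)) (g (1 ⊗ₜ y))) :=
    hev.comp (D.continuous_psiAdelic_apply _ _)
  obtain ⟨c, hc⟩ := exists_valuation_le_of_isCompact v (h𝒦.image hc)
  refine le_one_of_pow_mul_le (b := v.valuation ℚ (D.psi x y)) (c := c)
    ((v.valuation ℚ).ne_zero_iff.2 hxy) fun k => ?_
  have h1 := hc _ ⟨toAdelic g ^ k, 𝒦.pow_mem hg k, rfl⟩
  simp only at h1
  rw [← map_pow, toAdelic_tmul, toAdelic_tmul, evalPlace_psiAdelic_tmul, D.psi_pow_apply h] at h1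
  rw [← map_pow, ← map_mul, ← IsDedekindDomain.HeightOneSpectrum.valuedAdicCompletion_eq_valuation']
  rwa [IsDedekindDomain.HeightOneSpectrum.algebraMap_adicCompletion] at h1

/-- The elements of `Γ` preserve `psi`: their similitude factor is a positive rational number that
is a unit at all primes. -/
theorem psi_Gamma (D : Datum K V) {𝒦 : Subgroup (AdelicGL V)}
    (h𝒦 : @IsCompact _ (adelicTopology V) (𝒦 : Set (AdelicGL V))) {γ : D.GUPos}
    (hγ : γ ∈ D.Gamma 𝒦) (x y : V) : D.psi (γ.1 x) (γ.1 y) = D.psi x y := by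
  obtain ⟨r, hr, h⟩ := γ.2
  have hγ' : toAdelic γ.1 ∈ 𝒦 := hγ
  by_cases hxy : D.psi x y = 0
  · rw [h, hxy, mul_zero]
  have hinv : ∀ x y, D.psi (γ.1⁻¹ x) (γ.1⁻¹ y) = r⁻¹ * D.psi x y := by
    intro x y
    rw [eq_inv_mul_iff_mul_eq₀ hr.ne', ← h, ← LinearEquiv.mul_apply, ← LinearEquiv.mul_apply,
      mul_inv_cancel, LinearEquiv.coe_one, id, id]
  have hr1 : r = 1 := rat_eq_one_of_valuation_le_one hr
    (D.valuation_similitude_le_one h𝒦 h hγ' hxy)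
    (D.valuation_similitude_le_one h𝒦 hinv (by rw [map_inv]; exact 𝒦.inv_mem hγ') hxy)
  rw [h, hr1, one_mul]

end Datum

/-! ### Isometries of signature `(m, n)` -/

section LocalIsometry

variable {m n : ℕ}

/-- The matrix of `x ↦ x₁ - z x₂`, the holomorphic part of the period map at one place. -/
def holForm (z : Matrix (Fin m) (Fin n) ℂ) : Matrix (Fin m) (Fin m ⊕ Fin n) ℂ :=
  Matrix.fromCols 1 (-z)

/-- The matrix of `x ↦ ᵗz̄ x₁ - x₂`, the complex conjugate of the antiholomorphic part of the
period map at one place. -/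
def antiForm (z : Matrix (Fin m) (Fin n) ℂ) : Matrix (Fin n) (Fin m ⊕ Fin n) ℂ :=
  Matrix.fromCols zᴴ (-1)

theorem holForm_mulVec (z : Matrix (Fin m) (Fin n) ℂ) (x : Fin m ⊕ Fin n → ℂ) :
    holForm z *ᵥ x = x ∘ Sum.inl - z *ᵥ (x ∘ Sum.inr) := by
  rw [holForm, Matrix.fromCols_mulVec, Matrix.one_mulVec, Matrix.neg_mulVec, sub_eq_add_neg]

theorem antiForm_mulVec (z : Matrix (Fin m) (Fin n) ℂ) (x : Fin m ⊕ Fin n → ℂ) :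
    antiForm z *ᵥ x = zᴴ *ᵥ (x ∘ Sum.inl) - x ∘ Sum.inr := by
  rw [antiForm, Matrix.fromCols_mulVec, Matrix.neg_mulVec, Matrix.one_mulVec, sub_eq_add_neg]

theorem eq_one_of_mul_holForm {z : Matrix (Fin m) (Fin n) ℂ} {A : Matrix (Fin m) (Fin m) ℂ}
    (h : A * holForm z = holForm z) : A = 1 := by
  rw [holForm, Matrix.mul_fromCols, Matrix.mul_one, Matrix.fromCols_inj.eq_iff] at h
  exact h.1

theorem eq_one_of_mul_antiForm {z : Matrix (Fin m) (Fin n) ℂ} {A : Matrix (Fin n) (Fin n) ℂ}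
    (h : A * antiForm z = antiForm z) : A = 1 := by
  rw [antiForm, Matrix.mul_fromCols, Matrix.mul_neg, Matrix.mul_one,
    Matrix.fromCols_inj.eq_iff] at h
  exact neg_injective h.2

/-- `ᵗλ` carries the linear form of `g z`, transformed by `g`, to the linear form of `z`. This is
how the factor of automorphy enters the comparison of periods. -/
theorem lam_transpose_mul {g : Matrix (Fin m ⊕ Fin n) (Fin m ⊕ Fin n) ℂ}
    (h : gᴴ * signMat m n * g = signMat m n) {z z' : Matrix (Fin m) (Fin n) ℂ} (hz : InDomain z)
    (hz' : z' * mu g z = g.toBlocks₁₁ * z + g.toBlocks₁₂) :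
    (lam g z)ᵀ * (holForm z' * g) = holForm z := by
  have hu : IsUnit (mu g z).det := isUnit_det_mu ⟨1, one_pos, by simpa using h⟩ hz
  obtain ⟨h1, h2, h3, h4⟩ := posSimilitude_blocks (r := 1) (by simpa using h)
  rw [Complex.ofReal_one, one_smul] at h1 h4
  have hl : (lam g z)ᵀ = z * g.toBlocks₁₂ᴴ + g.toBlocks₁₁ᴴ := by
    rw [lam, Matrix.transpose_add, Matrix.transpose_mul, Matrix.transpose_transpose]
    rfl
  have hg : holForm z' * g = holForm z' * Matrix.fromBlocks g.toBlocks₁₁ g.toBlocks₁₂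
      g.toBlocks₂₁ g.toBlocks₂₂ := by rw [Matrix.fromBlocks_toBlocks]
  rw [hg, holForm, holForm, Matrix.fromCols_mul_fromBlocks, Matrix.mul_fromCols, Matrix.one_mul, Matrix.one_mul, hl]
  unfold mu at hz' hu
  set a := g.toBlocks₁₁
  set b := g.toBlocks₁₂
  set c := g.toBlocks₂₁
  set d := g.toBlocks₂₂
  -- Both sides agree after multiplication by the invertible matrix `μ = c z + d`.
  have key : (z * bᴴ + aᴴ) * z' = z * dᴴ + cᴴ := by
    have e : (z * bᴴ + aᴴ) * z' * (c * z + d) - (z * dᴴ + cᴴ) * (c * z + d) = 0 := by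
      rw [Matrix.mul_assoc, hz']
      have e' : (z * bᴴ + aᴴ) * (a * z + b) - (z * dᴴ + cᴴ) * (c * z + d) =
          z * (bᴴ * a - dᴴ * c) * z + z * (bᴴ * b - dᴴ * d) + (aᴴ * a - cᴴ * c) * z +
            (aᴴ * b - cᴴ * d) := by
        simp only [Matrix.add_mul, Matrix.mul_add, Matrix.mul_sub, Matrix.sub_mul,
          Matrix.mul_assoc]
        abel
      rw [e', h1, h2, h3, h4]
      simp
    rw [← Matrix.sub_mul] at e
    have e2 := congrArg (· * (c * z + d)⁻¹) e
    simp only [Matrix.mul_assoc, Matrix.mul_nonsing_inv _ hu, Matrix.mul_one,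
      Matrix.zero_mul] at e2
    exact sub_eq_zero.1 e2
  congr 1
  · have e' : (z * bᴴ + aᴴ) * (a + -z' * c) =
        (z * bᴴ + aᴴ) * a - ((z * bᴴ + aᴴ) * z') * c := by
      rw [Matrix.mul_add, Matrix.neg_mul, Matrix.mul_neg, Matrix.mul_assoc _ z' c,
        sub_eq_add_neg]
    have e2 : (z * bᴴ + aᴴ) * a - (z * dᴴ + cᴴ) * c =
        z * (bᴴ * a - dᴴ * c) + (aᴴ * a - cᴴ * c) := by
      simp only [Matrix.add_mul, Matrix.mul_sub, Matrix.mul_assoc]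
      abel
    rw [e', key, e2, h1, h3]
    simp
  · have e' : (z * bᴴ + aᴴ) * (b + -z' * d) =
        (z * bᴴ + aᴴ) * b - ((z * bᴴ + aᴴ) * z') * d := by
      rw [Matrix.mul_add, Matrix.neg_mul, Matrix.mul_neg, Matrix.mul_assoc _ z' d,
        sub_eq_add_neg]
    have e2 : (z * bᴴ + aᴴ) * b - (z * dᴴ + cᴴ) * d =
        z * (bᴴ * b - dᴴ * d) + (aᴴ * b - cᴴ * d) := by
      simp only [Matrix.add_mul, Matrix.mul_sub, Matrix.mul_assoc]
      abel
    rw [e', key, e2, h2, h4]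
    simp

/-- The counterpart of `lam_transpose_mul` for `μ`, in the complex conjugate coordinates. -/
theorem mu_conjTranspose_mul {g : Matrix (Fin m ⊕ Fin n) (Fin m ⊕ Fin n) ℂ}
    (h : gᴴ * signMat m n * g = signMat m n) {z z' : Matrix (Fin m) (Fin n) ℂ}
    (hz' : z' * mu g z = g.toBlocks₁₁ * z + g.toBlocks₁₂) :
    (mu g z)ᴴ * (antiForm z' * g) = antiForm z := by
  obtain ⟨h1, h2, h3, h4⟩ := posSimilitude_blocks (r := 1) (by simpa using h)
  rw [Complex.ofReal_one, one_smul] at h1 h4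
  have key := congrArg Matrix.conjTranspose hz'
  rw [Matrix.conjTranspose_mul, Matrix.conjTranspose_add, Matrix.conjTranspose_mul] at key
  have hg : antiForm z' * g = antiForm z' * Matrix.fromBlocks g.toBlocks₁₁ g.toBlocks₁₂
      g.toBlocks₂₁ g.toBlocks₂₂ := by rw [Matrix.fromBlocks_toBlocks]
  rw [hg, antiForm, antiForm, Matrix.fromCols_mul_fromBlocks, Matrix.mul_fromCols, Matrix.neg_mul, Matrix.neg_mul,
    Matrix.one_mul, Matrix.one_mul, Matrix.mul_add, Matrix.mul_add, ← Matrix.mul_assoc,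
    ← Matrix.mul_assoc, key]
  have hm : (mu g z)ᴴ = zᴴ * g.toBlocks₂₁ᴴ + g.toBlocks₂₂ᴴ := by
    rw [mu, Matrix.conjTranspose_add, Matrix.conjTranspose_mul]
  rw [hm]
  set a := g.toBlocks₁₁
  set b := g.toBlocks₁₂
  set c := g.toBlocks₂₁
  set d := g.toBlocks₂₂
  congr 1
  · have e : (zᴴ * aᴴ + bᴴ) * a + (zᴴ * cᴴ + dᴴ) * -c =
        zᴴ * (aᴴ * a - cᴴ * c) + (bᴴ * a - dᴴ * c) := by
      simp only [Matrix.add_mul, Matrix.mul_sub, Matrix.mul_assoc, Matrix.mul_neg]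
      abel
    rw [e, h1, h3]
    simp
  · have e : (zᴴ * aᴴ + bᴴ) * b + (zᴴ * cᴴ + dᴴ) * -d =
        zᴴ * (aᴴ * b - cᴴ * d) + (bᴴ * b - dᴴ * d) := by
      simp only [Matrix.add_mul, Matrix.mul_sub, Matrix.mul_assoc, Matrix.mul_neg]
      abel
    rw [e, h2, h4]
    simp

theorem moebius_mul_mu {g : Matrix (Fin m ⊕ Fin n) (Fin m ⊕ Fin n) ℂ} (hg : IsPosSimilitude g)
    {z : Matrix (Fin m) (Fin n) ℂ} (hz : InDomain z) :
    moebius g z * mu g z = g.toBlocks₁₁ * z + g.toBlocks₁₂ := by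
  rw [moebius, Matrix.mul_assoc, Matrix.nonsing_inv_mul _ (isUnit_det_mu hg hz), Matrix.mul_one]

theorem mul_mu_of_mul_holForm_eq {g : Matrix (Fin m ⊕ Fin n) (Fin m ⊕ Fin n) ℂ}
    {z z' : Matrix (Fin m) (Fin n) ℂ} {N : Matrix (Fin m) (Fin m) ℂ}
    (h : N * holForm z = holForm z' * g) :
    z' * mu g z = g.toBlocks₁₁ * z + g.toBlocks₁₂ := by
  have hg : holForm z' * g = holForm z' * Matrix.fromBlocks g.toBlocks₁₁ g.toBlocks₁₂
      g.toBlocks₂₁ g.toBlocks₂₂ := by rw [Matrix.fromBlocks_toBlocks]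
  rw [hg, holForm, holForm, Matrix.mul_fromCols, Matrix.fromCols_mul_fromBlocks,
    Matrix.fromCols_inj.eq_iff, Matrix.mul_one] at h
  obtain ⟨h1, h2⟩ := h
  rw [h1, Matrix.one_mul, Matrix.one_mul, Matrix.mul_neg, Matrix.add_mul, Matrix.neg_mul,
    Matrix.neg_mul, Matrix.neg_mul, neg_eq_iff_add_eq_zero] at h2
  rw [mu, ← sub_eq_zero, ← neg_eq_zero, ← h2, Matrix.mul_add, ← Matrix.mul_assoc]
  abel

theorem eq_moebius {g : Matrix (Fin m ⊕ Fin n) (Fin m ⊕ Fin n) ℂ} (hg : IsPosSimilitude g)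
    {z z' : Matrix (Fin m) (Fin n) ℂ} (hz : InDomain z)
    (h : z' * mu g z = g.toBlocks₁₁ * z + g.toBlocks₁₂) : z' = moebius g z := by
  rw [moebius, ← h, Matrix.mul_assoc, Matrix.mul_nonsing_inv _ (isUnit_det_mu hg hz),
    Matrix.mul_one]

end LocalIsometry

/-! ### Linear maps that commute with a diagonal action -/

section DiagonalAction

variable {K : Type u} [Field K] {I J : Type*} [Fintype I] [DecidableEq I] [Fintype J]

theorem apply_single_eq_zero {χ : I → K →+* ℂ} {L : (I → ℂ) →ₗ[ℂ] (I → ℂ)}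
    (hL : ∀ b p, L (diagAct χ b p) = diagAct χ b (L p)) {i k : I} (hik : χ k ≠ χ i) :
    L (Pi.single k 1) i = 0 := by
  obtain ⟨b, hb⟩ : ∃ b, χ k b ≠ χ i b := by
    by_contra hcon
    push Not at hcon
    exact hik (RingHom.ext hcon)
  have h2 : diagAct χ b (Pi.single k 1) = χ k b • Pi.single k (1 : ℂ) := by
    ext l
    rw [diagAct_apply, Pi.smul_apply, smul_eq_mul]
    rcases eq_or_ne l k with rfl | hl
    · rfl
    · simp [hl]
  have h1 := congrFun (hL b (Pi.single k 1)) i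
  rw [h2, map_smul, diagAct_apply, Pi.smul_apply, smul_eq_mul, ← sub_eq_zero, ← sub_mul] at h1
  exact (mul_eq_zero.1 h1).resolve_left (sub_ne_zero.2 hb)

/-- The block, on the coordinates `e`, of an endomorphism of `ℂ^I`. -/
def block (e : J → I) (L : (I → ℂ) →ₗ[ℂ] (I → ℂ)) : Matrix J J ℂ :=
  Matrix.of fun i j => L (Pi.single (e j) 1) (e i)

theorem apply_comp_eq_block_mulVec {χ : I → K →+* ℂ} {L : (I → ℂ) →ₗ[ℂ] (I → ℂ)}
    (hL : ∀ b p, L (diagAct χ b p) = diagAct χ b (L p)) {τ : K →+* ℂ} {e : J → I}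
    (he : Function.Injective e) (h : ∀ i, χ i = τ ↔ i ∈ Set.range e) (p : I → ℂ) :
    L p ∘ e = block e L *ᵥ (p ∘ e) := by
  ext i
  have h1 : L p (e i) = ∑ k, p k * L (Pi.single k 1) (e i) := by
    conv_lhs => rw [pi_eq_sum_univ' p]
    simp [Finset.sum_apply]
  rw [Function.comp_apply, h1]
  symm
  refine Fintype.sum_of_injective e he _ _ (fun k hk => ?_) (fun j => mul_comm _ _)
  rw [apply_single_eq_zero hL, mul_zero]
  rw [(h (e i)).2 ⟨i, rfl⟩]
  exact fun h' => hk ((h k).1 h')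

theorem dual_apply_single_eq_block {χ : I → K →+* ℂ} {L : (I → ℂ) →ₗ[ℂ] (I → ℂ)}
    (hL : ∀ b p, L (diagAct χ b p) = diagAct χ b (L p)) {τ : K →+* ℂ} {e : J → I}
    (he : Function.Injective e) (h : ∀ i, χ i = τ ↔ i ∈ Set.range e)
    (ω : (I → ℂ) →ₗ[ℂ] ℂ) :
    (fun j => ω (L (Pi.single (e j) 1))) = (block e L)ᵀ *ᵥ fun i => ω (Pi.single (e i) 1) := by
  ext j
  have h1 : ω (L (Pi.single (e j) 1)) =
      ∑ k, L (Pi.single (e j) 1) k * ω (Pi.single k 1) := by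
    conv_lhs => rw [pi_eq_sum_univ' (L (Pi.single (e j) 1))]
    simp
  rw [h1]
  symm
  refine Fintype.sum_of_injective e he _ _ (fun k hk => ?_) (fun j => rfl)
  rw [apply_single_eq_zero hL, zero_mul]
  rw [(h (e j)).2 ⟨j, rfl⟩]
  exact fun h' => hk ((h k).1 h'.symm)

end DiagonalAction

/-! ### Comparison of period maps -/

namespace Datum

variable {K : Type u} [Field K] [NumberField K] [IsCMField K]
    {V : Type v} [AddCommGroup V] [Module K V] [Module ℚ V] [IsScalarTower ℚ K V]
    [FiniteDimensional ℚ V]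

/-- The index of a coordinate on which `K` acts via `τ`. -/
def fstIdx (D : Datum K V) (τ : D.cmType) (i : Fin (D.m τ)) : D.Coord := ⟨τ, .inl i⟩

/-- The index of a coordinate on which `K` acts via the conjugate of `τ`. -/
def sndIdx (D : Datum K V) (τ : D.cmType) (j : Fin (D.n τ)) : D.Coord := ⟨τ, .inr j⟩

theorem fstIdx_injective (D : Datum K V) (τ : D.cmType) : Function.Injective (D.fstIdx τ) :=
  fun a b h => by simpa [fstIdx] using h

theorem sndIdx_injective (D : Datum K V) (τ : D.cmType) : Function.Injective (D.sndIdx τ) :=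
  fun a b h => by simpa [sndIdx] using h

theorem period_comp_fstIdx (D : Datum K V) (z : D.Domain) (τ : D.cmType) (v : V) :
    D.period z v ∘ D.fstIdx τ = holForm (z.1 τ) *ᵥ D.frame τ v :=
  (holForm_mulVec _ _).symm

theorem period_comp_sndIdx (D : Datum K V) (z : D.Domain) (τ : D.cmType) (v : V) :
    D.period z v ∘ D.sndIdx τ = star (antiForm (z.1 τ) *ᵥ D.frame τ v) := by
  rw [antiForm_mulVec, star_sub, Matrix.star_mulVec, Matrix.conjTranspose_conjTranspose,
    ← Matrix.mulVec_transpose]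
  rfl

/-- The coordinate vectors of elements of `V` span, so they separate matrices. -/
theorem matrix_ext_of_frame (D : Datum K V) (τ : D.cmType) {k : Type*}
    {M N : Matrix k (Fin (D.m τ) ⊕ Fin (D.n τ)) ℂ}
    (h : ∀ v, M *ᵥ D.frame τ v = N *ᵥ D.frame τ v) : M = N := by
  have h1 : M.mulVecLin = N.mulVecLin := LinearMap.ext_on_range (D.frame_span τ) h
  ext i j
  simpa using congrFun (LinearMap.congr_fun h1 (Pi.single j 1)) i

theorem localMatrix_isometry (D : Datum K V) {γ : V ≃ₗ[K] V}
    (h : ∀ x y, D.psi (γ x) (γ y) = D.psi x y) (τ : D.cmType) :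
    (D.localMatrix τ γ)ᴴ * signMat _ _ * D.localMatrix τ γ = signMat (D.m τ) (D.n τ) := by
  have h' : ∀ x y, D.psi (γ x) (γ y) = (1 : ℚ) * D.psi x y := fun x y => by rw [h, one_mul]
  refine D.matrix_ext_of_frame τ fun v => star_injective ?_
  have h1 : ∀ w, star (((D.localMatrix τ γ)ᴴ * signMat _ _ * D.localMatrix τ γ) *ᵥ D.frame τ v)
      ⬝ᵥ D.frame τ w = star (signMat (D.m τ) (D.n τ) *ᵥ D.frame τ v) ⬝ᵥ D.frame τ w := by
    intro w
    apply star_injective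
    rw [← Matrix.star_dotProduct (D.frame τ w), ← Matrix.star_dotProduct (D.frame τ w),
      ← D.frame_herm,
      ← Matrix.mulVec_mulVec, ← Matrix.mulVec_mulVec, Matrix.dotProduct_mulVec,
      ← Matrix.star_mulVec, D.localMatrix_mulVec, D.localMatrix_mulVec, ← D.frame_herm,
      D.herm_similitude h', Rat.cast_one, one_mul]
  have h2 := D.matrix_ext_of_frame τ (k := Unit)
    (M := Matrix.of fun _ => star (((D.localMatrix τ γ)ᴴ * signMat _ _ * D.localMatrix τ γ) *ᵥ
      D.frame τ v)) (N := Matrix.of fun _ => star (signMat (D.m τ) (D.n τ) *ᵥ D.frame τ v))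
    fun w => funext fun _ => h1 w
  exact congrFun h2 ()

theorem act_mul_mu (D : Datum K V) (γ : D.GUPos) (z : D.Domain) (τ : D.cmType) :
    (D.act γ z).1 τ * mu (D.localMatrix τ γ.1) (z.1 τ) =
      (D.localMatrix τ γ.1).toBlocks₁₁ * z.1 τ + (D.localMatrix τ γ.1).toBlocks₁₂ :=
  moebius_mul_mu (D.isPosSimilitude_localMatrix τ γ) (z.2 τ)

section Comparison

variable (D : Datum K V) {z z' : D.Domain} {γ : D.GUPos}
  {L : (D.Coord → ℂ) →ₗ[ℂ] (D.Coord → ℂ)}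
  (hL : ∀ b p, L (diagAct D.coordEmb b p) = diagAct D.coordEmb b (L p))
  (hper : ∀ v, D.period z' (γ.1 v) = L (D.period z v))

include hL hper

theorem block_fst_mul_holForm (τ : D.cmType) [DecidableEq D.Coord] :
    block (D.fstIdx τ) L * holForm (z.1 τ) = holForm (z'.1 τ) * D.localMatrix τ γ.1 := by
  refine D.matrix_ext_of_frame τ fun v => ?_
  rw [← Matrix.mulVec_mulVec, ← Matrix.mulVec_mulVec, D.localMatrix_mulVec,
    ← D.period_comp_fstIdx, ← D.period_comp_fstIdx, hper,
    apply_comp_eq_block_mulVec hL (D.fstIdx_injective τ) (D.coordEmb_eq_iff τ)]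

theorem block_snd_mul_antiForm (τ : D.cmType) [DecidableEq D.Coord] :
    (block (D.sndIdx τ) L).map conj * antiForm (z.1 τ) =
      antiForm (z'.1 τ) * D.localMatrix τ γ.1 := by
  refine D.matrix_ext_of_frame τ fun v => star_injective ?_
  rw [← Matrix.mulVec_mulVec, ← Matrix.mulVec_mulVec, D.localMatrix_mulVec,
    ← D.period_comp_sndIdx, hper,
    apply_comp_eq_block_mulVec hL (D.sndIdx_injective τ) (D.coordEmb_eq_conj_iff τ),
    D.period_comp_sndIdx]
  generalize antiForm (z.1 τ) *ᵥ D.frame τ v = y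
  ext i
  simp [Matrix.mulVec, dotProduct]

/-- A `ℂ`-linear map that matches the periods at `z` with those at `z'` through `γ` exists only if
`z' = γ z`: then `γ` carries the kernel of the linear form `(1, -z)` to that of `(1, -z')`. -/
theorem eq_act_of_period : z' = D.act γ z := by
  classical
  refine Subtype.ext (funext fun τ => ?_)
  exact eq_moebius (D.isPosSimilitude_localMatrix τ γ) (z.2 τ)
    (mul_mu_of_mul_holForm_eq (D.block_fst_mul_holForm hL hper τ))

theorem lam_transpose_mul_block (hγ : ∀ x y, D.psi (γ.1 x) (γ.1 y) = D.psi x y)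
    (τ : D.cmType) [DecidableEq D.Coord] :
    (lam (D.localMatrix τ γ.1) (z.1 τ))ᵀ * block (D.fstIdx τ) L = 1 := by
  have h := D.block_fst_mul_holForm hL hper τ
  refine eq_one_of_mul_holForm (z := z.1 τ) ?_
  rw [Matrix.mul_assoc, h]
  exact lam_transpose_mul (D.localMatrix_isometry hγ τ) (z.2 τ) (mul_mu_of_mul_holForm_eq h)

theorem mu_transpose_mul_block (hγ : ∀ x y, D.psi (γ.1 x) (γ.1 y) = D.psi x y)
    (τ : D.cmType) [DecidableEq D.Coord] :
    (mu (D.localMatrix τ γ.1) (z.1 τ))ᵀ * block (D.sndIdx τ) L = 1 := by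
  have h : (mu (D.localMatrix τ γ.1) (z.1 τ))ᴴ * (block (D.sndIdx τ) L).map conj = 1 := by
    refine eq_one_of_mul_antiForm (z := z.1 τ) ?_
    rw [Matrix.mul_assoc, D.block_snd_mul_antiForm hL hper τ]
    exact mu_conjTranspose_mul (D.localMatrix_isometry hγ τ)
      (mul_mu_of_mul_holForm_eq (D.block_fst_mul_holForm hL hper τ))
  have h' := congrArg (fun M => M.map conj) h
  simp only [Matrix.map_mul] at h'
  rw [Matrix.map_one _ (map_zero _) (map_one _)] at h'
  rw [← h']
  congr 1
  · ext i j; simp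
  · ext i j; simp

end Comparison

/-- The block diagonal automorphism of `ℂ^g` given by an element of `H(ℂ)`. -/
def blockEquiv (D : Datum K V) (h : D.H) : (D.Coord → ℂ) ≃ₗ[ℂ] (D.Coord → ℂ) where
  toFun p := fun
    | ⟨τ, .inl i⟩ => ((h τ).1.val *ᵥ (p ∘ D.fstIdx τ)) i
    | ⟨τ, .inr j⟩ => ((h τ).2.val *ᵥ (p ∘ D.sndIdx τ)) j
  invFun p := fun
    | ⟨τ, .inl i⟩ => ((h τ).1⁻¹.val *ᵥ (p ∘ D.fstIdx τ)) i
    | ⟨τ, .inr j⟩ => ((h τ).2⁻¹.val *ᵥ (p ∘ D.sndIdx τ)) j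
  map_add' p q := by
    ext ⟨τ, i | j⟩
    · exact congrFun (Matrix.mulVec_add _ (p ∘ D.fstIdx τ) (q ∘ D.fstIdx τ)) i
    · exact congrFun (Matrix.mulVec_add _ (p ∘ D.sndIdx τ) (q ∘ D.sndIdx τ)) j
  map_smul' c p := by
    ext ⟨τ, i | j⟩
    · exact congrFun (Matrix.mulVec_smul _ c (p ∘ D.fstIdx τ)) i
    · exact congrFun (Matrix.mulVec_smul _ c (p ∘ D.sndIdx τ)) j
  left_inv p := by
    ext ⟨τ, i | j⟩
    · change ((h τ).1⁻¹.val *ᵥ ((h τ).1.val *ᵥ (p ∘ D.fstIdx τ))) i = _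
      rw [Matrix.mulVec_mulVec, ← Units.val_mul, inv_mul_cancel, Units.val_one, Matrix.one_mulVec]
      rfl
    · change ((h τ).2⁻¹.val *ᵥ ((h τ).2.val *ᵥ (p ∘ D.sndIdx τ))) j = _
      rw [Matrix.mulVec_mulVec, ← Units.val_mul, inv_mul_cancel, Units.val_one, Matrix.one_mulVec]
      rfl
  right_inv p := by
    ext ⟨τ, i | j⟩
    · change ((h τ).1.val *ᵥ ((h τ).1⁻¹.val *ᵥ (p ∘ D.fstIdx τ))) i = _
      rw [Matrix.mulVec_mulVec, ← Units.val_mul, mul_inv_cancel, Units.val_one, Matrix.one_mulVec]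
      rfl
    · change ((h τ).2.val *ᵥ ((h τ).2⁻¹.val *ᵥ (p ∘ D.sndIdx τ))) j = _
      rw [Matrix.mulVec_mulVec, ← Units.val_mul, mul_inv_cancel, Units.val_one, Matrix.one_mulVec]
      rfl

theorem blockEquiv_comp_fstIdx (D : Datum K V) (h : D.H) (p : D.Coord → ℂ) (τ : D.cmType) :
    D.blockEquiv h p ∘ D.fstIdx τ = (h τ).1.val *ᵥ (p ∘ D.fstIdx τ) := rfl

theorem blockEquiv_comp_sndIdx (D : Datum K V) (h : D.H) (p : D.Coord → ℂ) (τ : D.cmType) :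
    D.blockEquiv h p ∘ D.sndIdx τ = (h τ).2.val *ᵥ (p ∘ D.sndIdx τ) := rfl

theorem coord_ext (D : Datum K V) {p q : D.Coord → ℂ}
    (h₁ : ∀ τ, p ∘ D.fstIdx τ = q ∘ D.fstIdx τ) (h₂ : ∀ τ, p ∘ D.sndIdx τ = q ∘ D.sndIdx τ) :
    p = q := by
  ext ⟨τ, i | j⟩
  · exact congrFun (h₁ τ) i
  · exact congrFun (h₂ τ) j

theorem blockEquiv_diagAct (D : Datum K V) (h : D.H) (b : K) (p : D.Coord → ℂ) :
    D.blockEquiv h (diagAct D.coordEmb b p) = diagAct D.coordEmb b (D.blockEquiv h p) := by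
  have e1 : ∀ (τ : D.cmType) (q : D.Coord → ℂ), diagAct D.coordEmb b q ∘ D.fstIdx τ =
      (τ : K →+* ℂ) b • (q ∘ D.fstIdx τ) := fun _ _ => rfl
  have e2 : ∀ (τ : D.cmType) (q : D.Coord → ℂ), diagAct D.coordEmb b q ∘ D.sndIdx τ =
      ComplexEmbedding.conjugate (τ : K →+* ℂ) b • (q ∘ D.sndIdx τ) := fun _ _ => rfl
  refine D.coord_ext (fun τ => ?_) (fun τ => ?_)
  · rw [e1, blockEquiv_comp_fstIdx, blockEquiv_comp_fstIdx, e1, Matrix.mulVec_smul]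
  · rw [e2, blockEquiv_comp_sndIdx, blockEquiv_comp_sndIdx, e2, Matrix.mulVec_smul]

/-- The transposed factor of automorphy carries the periods at `γ z` back to those at `z`. -/
theorem blockEquiv_period (D : Datum K V) {γ : D.GUPos}
    (hγ : ∀ x y, D.psi (γ.1 x) (γ.1 y) = D.psi x y) (z : D.Domain) (v : V) :
    D.blockEquiv (transpose (D.autFactor γ z)) (D.period (D.act γ z) (γ.1 v)) =
      D.period z v := by
  refine D.coord_ext (fun τ => ?_) (fun τ => ?_)
  · rw [blockEquiv_comp_fstIdx, period_comp_fstIdx, period_comp_fstIdx, ← D.localMatrix_mulVec]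
    change (lam (D.localMatrix τ γ.1) (z.1 τ))ᵀ *ᵥ _ = _
    rw [Matrix.mulVec_mulVec, Matrix.mulVec_mulVec, Matrix.mul_assoc,
      lam_transpose_mul (D.localMatrix_isometry hγ τ) (z.2 τ) (D.act_mul_mu γ z τ)]
  · rw [blockEquiv_comp_sndIdx, period_comp_sndIdx, period_comp_sndIdx, ← D.localMatrix_mulVec]
    change (mu (D.localMatrix τ γ.1) (z.1 τ))ᵀ *ᵥ _ = _
    rw [← mu_conjTranspose_mul (D.localMatrix_isometry hγ τ) (D.act_mul_mu γ z τ),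
      ← Matrix.mulVec_mulVec, ← Matrix.mulVec_mulVec, Matrix.star_mulVec (mu _ _)ᴴ,
      Matrix.conjTranspose_conjTranspose, Matrix.mulVec_transpose]

end Datum

section Isogenies

variable {K : Type u} [Field K] [NumberField K] [IsCMField K]
    {V : Type v} [AddCommGroup V] [Module K V] [Module ℚ V] [IsScalarTower ℚ K V]
    [FiniteDimensional ℚ V] {D : Datum K V} {𝒦 : Subgroup (AdelicGL V)}

/-! ### The groupoid of isogenies and its action on frames -/

theorem exists_glEquiv_eq {k : ℕ} (e : (Fin k → ℂ) ≃ₗ[ℂ] (Fin k → ℂ)) :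
    ∃ g : GL (Fin k) ℂ, glEquiv g = e := by
  refine ⟨⟨LinearMap.toMatrix' e.toLinearMap, LinearMap.toMatrix' e.symm.toLinearMap, ?_, ?_⟩, ?_⟩
  · rw [← LinearMap.toMatrix'_comp]; simp
  · rw [← LinearMap.toMatrix'_comp]; simp
  · ext1 x
    rw [glEquiv_apply]
    change LinearMap.toMatrix' e.toLinearMap *ᵥ x = e x
    rw [LinearMap.toMatrix'_mulVec]
    rfl

theorem glEquiv_mul {k : ℕ} (g h : GL (Fin k) ℂ) (x : Fin k → ℂ) :
    glEquiv (g * h) x = glEquiv g (glEquiv h x) := by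
  rw [glEquiv_apply, glEquiv_apply, glEquiv_apply, Matrix.mulVec_mulVec, Units.val_mul]

theorem glEquiv_one {k : ℕ} (x : Fin k → ℂ) : glEquiv (1 : GL (Fin k) ℂ) x = x := by
  rw [glEquiv_apply, Units.val_one, Matrix.one_mulVec]

theorem glEquiv_injective {k : ℕ} {g h : GL (Fin k) ℂ} (hgh : ∀ x, glEquiv g x = glEquiv h x) :
    g = h := by
  refine Units.ext (Matrix.ext fun i j => ?_)
  simpa [glEquiv_apply] using congrFun (hgh (Pi.single j 1)) i

theorem glTranspose_glTranspose {k : ℕ} (g : GL (Fin k) ℂ) : glTranspose (glTranspose g) = g :=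
  Units.ext (Matrix.transpose_transpose _)

theorem Datum.transpose_transpose (g : D.H) : Datum.transpose (Datum.transpose g) = g :=
  funext fun _ => Prod.ext (glTranspose_glTranspose _) (glTranspose_glTranspose _)

namespace PELVariety

variable {A B C : PELVariety D 𝒦}

theorem baseChange_trans {M N P : Type*} [AddCommGroup M] [Module ℚ M] [AddCommGroup N]
    [Module ℚ N] [AddCommGroup P] [Module ℚ P] (e : M ≃ₗ[ℚ] N) (f : N ≃ₗ[ℚ] P)
    (x : FinAdele ⊗[ℚ] M) :
    (e.trans f).baseChange ℚ FinAdele M P x =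
      f.baseChange ℚ FinAdele N P (e.baseChange ℚ FinAdele M N x) := by
  induction x with
  | zero => simp
  | tmul a y => rfl
  | add a b ha hb => rw [map_add, map_add, map_add, ha, hb]

theorem baseChange_refl {M : Type*} [AddCommGroup M] [Module ℚ M] (x : FinAdele ⊗[ℚ] M) :
    (LinearEquiv.refl ℚ M).baseChange ℚ FinAdele M M x = x := by
  induction x with
  | zero => simp
  | tmul a y => rfl
  | add a b ha hb => rw [map_add, ha, hb]

/-- The identity isogeny. -/
def Isogeny.refl (A : PELVariety D 𝒦) : Isogeny A A where
  onH1 := LinearEquiv.refl _ _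
  onLie := LinearEquiv.refl _ _
  per_comm _ := rfl
  pol := ⟨1, one_ne_zero, fun x y => by simp⟩
  ι_H1 _ _ := rfl
  ι_Lie _ _ := rfl
  level := by
    have h : ∀ η : (FinAdele ⊗[ℚ] V) ≃ₗ[FinAdele] (FinAdele ⊗[ℚ] A.H1),
        η.trans ((LinearEquiv.refl ℚ A.H1).baseChange ℚ FinAdele A.H1 A.H1) = η :=
      fun η => LinearEquiv.ext fun x => baseChange_refl (η x)
    simp [h]

/-- The composite of two isogenies. -/
def Isogeny.trans (φ : Isogeny A B) (ψ : Isogeny B C) : Isogeny A C where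
  onH1 := φ.onH1.trans ψ.onH1
  onLie := φ.onLie.trans ψ.onLie
  per_comm x := by simp [ψ.per_comm, φ.per_comm]
  pol := by
    obtain ⟨r, hr, h⟩ := φ.pol
    obtain ⟨s, hs, h'⟩ := ψ.pol
    exact ⟨r * s, mul_ne_zero hr hs, fun x y => by rw [h, h', mul_assoc]; rfl⟩
  ι_H1 b x := by simp [ψ.ι_H1, φ.ι_H1]
  ι_Lie b p := by simp [ψ.ι_Lie, φ.ι_Lie]
  level := by
    have h : ∀ η : (FinAdele ⊗[ℚ] V) ≃ₗ[FinAdele] (FinAdele ⊗[ℚ] A.H1),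
        η.trans ((φ.onH1.trans ψ.onH1).baseChange ℚ FinAdele A.H1 C.H1) =
          (η.trans (φ.onH1.baseChange ℚ FinAdele A.H1 B.H1)).trans
            (ψ.onH1.baseChange ℚ FinAdele B.H1 C.H1) :=
      fun η => LinearEquiv.ext fun x => baseChange_trans _ _ (η x)
    rw [ψ.level, φ.level]
    ext η
    constructor
    · rintro ⟨_, ⟨η, hη, rfl⟩, rfl⟩
      exact ⟨η, hη, (h η).symm⟩
    · rintro ⟨η, hη, rfl⟩
      exact ⟨_, ⟨η, hη, rfl⟩, h η⟩

/-- The inverse of an isogeny. It exists because the isogenies considered are quasi-isogenies. -/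
def Isogeny.symm (φ : Isogeny A B) : Isogeny B A where
  onH1 := φ.onH1.symm
  onLie := φ.onLie.symm
  per_comm x := by
    rw [LinearEquiv.eq_symm_apply, ← φ.per_comm, LinearEquiv.apply_symm_apply]
  pol := by
    obtain ⟨r, hr, h⟩ := φ.pol
    refine ⟨r⁻¹, inv_ne_zero hr, fun x y => ?_⟩
    rw [h, LinearEquiv.apply_symm_apply, LinearEquiv.apply_symm_apply, inv_mul_cancel_left₀ hr]
  ι_H1 b x := by
    rw [LinearEquiv.symm_apply_eq, φ.ι_H1, LinearEquiv.apply_symm_apply]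
  ι_Lie b p := by
    rw [LinearEquiv.symm_apply_eq, φ.ι_Lie, LinearEquiv.apply_symm_apply]
  level := by
    have h : ∀ η : (FinAdele ⊗[ℚ] V) ≃ₗ[FinAdele] (FinAdele ⊗[ℚ] A.H1),
        (η.trans (φ.onH1.baseChange ℚ FinAdele A.H1 B.H1)).trans
          (φ.onH1.symm.baseChange ℚ FinAdele B.H1 A.H1) = η := fun η =>
      LinearEquiv.ext fun x => by
        rw [LinearEquiv.trans_apply, LinearEquiv.trans_apply, ← baseChange_trans,
          LinearEquiv.self_trans_symm, baseChange_refl]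
    rw [φ.level]
    ext η
    constructor
    · intro hη
      exact ⟨_, ⟨η, hη, rfl⟩, (h η).symm⟩
    · rintro ⟨_, ⟨η, hη, rfl⟩, rfl⟩
      rw [h]
      exact hη

/-- Pull-back of invariant differentials as a linear isomorphism. -/
def Isogeny.pullbackEquiv (φ : Isogeny A B) (τ : K →+* ℂ) : B.Omega τ ≃ₗ[ℂ] A.Omega τ where
  toFun := φ.pullback τ
  invFun := φ.symm.pullback τ
  map_add' _ _ := rfl
  map_smul' _ _ := rfl
  left_inv ω := Subtype.ext (LinearMap.ext fun p => congrArg ω.1 (φ.onLie.apply_symm_apply p))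
  right_inv ω := Subtype.ext (LinearMap.ext fun p => congrArg ω.1 (φ.onLie.symm_apply_apply p))

/-- The element `h` of `H(ℂ)` relates the frame `m` of `B` and the frame `l` of `A`, pulled back
along `φ`, by `l(φ^* ω) = h m(ω)`. -/
def Isogeny.Relates (φ : Isogeny A B) (l : A.Frames) (h : D.H) (m : B.Frames) : Prop :=
  ∀ τ : D.cmType, (∀ ω, (l τ).1 (φ.pullback _ ω) = glEquiv (h τ).1 ((m τ).1 ω)) ∧
    ∀ ω, (l τ).2 (φ.pullback _ ω) = glEquiv (h τ).2 ((m τ).2 ω)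

theorem Isogeny.Relates.refl (l : A.Frames) : (Isogeny.refl A).Relates l 1 l :=
  fun _ => ⟨fun _ => (glEquiv_one _).symm, fun _ => (glEquiv_one _).symm⟩

theorem Isogeny.Relates.trans {φ : Isogeny A B} {ψ : Isogeny B C} {l : A.Frames} {m : B.Frames}
    {n : C.Frames} {h k : D.H} (hφ : φ.Relates l h m) (hψ : ψ.Relates m k n) :
    (φ.trans ψ).Relates l (h * k) n := by
  refine fun τ => ⟨fun ω => ?_, fun ω => ?_⟩
  · change (l τ).1 (φ.pullback _ (ψ.pullback _ ω)) = glEquiv ((h τ).1 * (k τ).1) _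
    rw [(hφ τ).1, (hψ τ).1, glEquiv_mul]
  · change (l τ).2 (φ.pullback _ (ψ.pullback _ ω)) = glEquiv ((h τ).2 * (k τ).2) _
    rw [(hφ τ).2, (hψ τ).2, glEquiv_mul]

theorem Isogeny.Relates.symm {φ : Isogeny A B} {l : A.Frames} {m : B.Frames} {h : D.H}
    (hφ : φ.Relates l h m) : φ.symm.Relates m h⁻¹ l := by
  refine fun τ => ⟨fun ω => ?_, fun ω => ?_⟩
  · have e := (hφ τ).1 (φ.symm.pullback _ ω)
    have e' : φ.pullback _ (φ.symm.pullback _ ω) = ω :=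
      (φ.pullbackEquiv (τ : K →+* ℂ)).apply_symm_apply ω
    rw [e'] at e
    rw [e, ← glEquiv_mul]
    change _ = glEquiv ((h τ).1⁻¹ * (h τ).1) _
    rw [inv_mul_cancel, glEquiv_one]
  · have e := (hφ τ).2 (φ.symm.pullback _ ω)
    have e' : φ.pullback _ (φ.symm.pullback _ ω) = ω :=
      (φ.pullbackEquiv (ComplexEmbedding.conjugate (τ : K →+* ℂ))).apply_symm_apply ω
    rw [e'] at e
    rw [e, ← glEquiv_mul]
    change _ = glEquiv ((h τ).2⁻¹ * (h τ).2) _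
    rw [inv_mul_cancel, glEquiv_one]

theorem Isogeny.Relates.unique {φ : Isogeny A B} {l : A.Frames} {m : B.Frames} {h k : D.H}
    (hh : φ.Relates l h m) (hk : φ.Relates l k m) : h = k := by
  refine funext fun τ => Prod.ext (glEquiv_injective fun x => ?_) (glEquiv_injective fun x => ?_)
  · obtain ⟨ω, rfl⟩ := (m τ).1.surjective x
    rw [← (hh τ).1, (hk τ).1]
  · obtain ⟨ω, rfl⟩ := (m τ).2.surjective x
    rw [← (hh τ).2, (hk τ).2]

theorem Isogeny.exists_relates (φ : Isogeny A B) (l : A.Frames) (m : B.Frames) :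
    ∃ h : D.H, φ.Relates l h m := by
  choose g hg using fun τ : D.cmType => exists_glEquiv_eq
    (((m τ).1.symm.trans (φ.pullbackEquiv _)).trans (l τ).1)
  choose k hk using fun τ : D.cmType => exists_glEquiv_eq
    (((m τ).2.symm.trans (φ.pullbackEquiv _)).trans (l τ).2)
  refine ⟨fun τ => (g τ, k τ), fun τ => ⟨fun ω => ?_, fun ω => ?_⟩⟩
  · rw [hg, LinearEquiv.trans_apply, LinearEquiv.trans_apply, LinearEquiv.symm_apply_apply]
    rfl
  · rw [hk, LinearEquiv.trans_apply, LinearEquiv.trans_apply, LinearEquiv.symm_apply_apply]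
    rfl

theorem Isogeny.Relates.smul {φ : Isogeny A B} {l : A.Frames} {m : B.Frames} {h : D.H}
    (hφ : φ.Relates l h m) (g : D.H) : φ.Relates l (h * Datum.transpose g) (m.smul g) := by
  refine fun τ => ⟨fun ω => ?_, fun ω => ?_⟩
  · change _ = glEquiv ((h τ).1 * glTranspose (g τ).1)
      ((glEquiv (glTranspose (g τ).1)).symm ((m τ).1 ω))
    rw [(hφ τ).1, glEquiv_mul, LinearEquiv.apply_symm_apply]
  · change _ = glEquiv ((h τ).2 * glTranspose (g τ).2)
      ((glEquiv (glTranspose (g τ).2)).symm ((m τ).2 ω))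
    rw [(hφ τ).2, glEquiv_mul, LinearEquiv.apply_symm_apply]

theorem Isogeny.relates_one_iff (φ : Isogeny A B) (l : A.Frames) (m : B.Frames) :
    φ.Relates l 1 m ↔ ∀ τ : D.cmType, (∀ ω, (m τ).1 ω = (l τ).1 (φ.pullback _ ω)) ∧
      ∀ ω, (m τ).2 ω = (l τ).2 (φ.pullback _ ω) := by
  have e1 : ∀ τ x, glEquiv ((1 : D.H) τ).1 x = x := fun τ x => glEquiv_one x
  have e2 : ∀ τ x, glEquiv ((1 : D.H) τ).2 x = x := fun τ x => glEquiv_one x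
  simp only [Isogeny.Relates, e1, e2, eq_comm]

end PELVariety

end Isogenies

section Family

variable {K : Type u} [Field K] [NumberField K] [IsCMField K]
    {V : Type v} [AddCommGroup V] [Module K V] [Module ℚ V] [IsScalarTower ℚ K V]
    [FiniteDimensional ℚ V] {D : Datum K V} {𝒦 : Subgroup (AdelicGL V)}

namespace Datum

/-! ### Isogenies between members of the family -/

/-- If an isomorphism of complex tori matches the polarization forms up to a rational factor, the
factor can be taken positive, since both forms are positive on `(p, i p)`. -/
theorem exists_pos_factor {z z' : D.Domain} {g : V → V}
    {L : (D.Coord → ℂ) ≃ₗ[ℂ] (D.Coord → ℂ)}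
    (hper : ∀ v, D.period z' (g v) = L (D.period z v)) {r : ℚ}
    (h : ∀ x y, D.psi x y = r * D.psi (g x) (g y)) :
    ∃ s : ℚ, 0 < s ∧ ∀ x y, D.psi (g x) (g y) = s * D.psi x y := by
  by_cases hp : ∃ p : D.Coord → ℂ, p ≠ 0
  · obtain ⟨p, hp⟩ := hp
    let L' : (D.Coord → ℂ) →ₗ[ℝ] (D.Coord → ℂ) := L.toLinearMap.restrictScalars ℝ
    have hE : D.riemann z = (r : ℝ) • (D.riemann z').compl₁₂ L' L' := by
      refine LinearMap.ext_on_range (D.period_span z) fun x =>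
        LinearMap.ext_on_range (D.period_span z) fun y => ?_
      rw [D.riemann_period, h]
      change _ = (r : ℝ) * D.riemann z' (L (D.period z x)) (L (D.period z y))
      rw [← hper, ← hper, D.riemann_period]
      push_cast
      rfl
    have h1 : 0 < (r : ℝ) * D.riemann z' (L p) (Complex.I • L p) := by
      rw [← map_smul]
      have := D.riemann_pos z hp
      rw [hE] at this
      exact this
    have h2 := D.riemann_pos z' (p := L p) (by simpa using hp)
    have hr : 0 < r := by exact_mod_cast pos_of_mul_pos_left h1 h2.le
    exact ⟨r⁻¹, inv_pos.2 hr, fun x y => by rw [h x y, inv_mul_cancel_left₀ hr.ne']⟩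
  · push Not at hp
    -- Here `ℂ^g` is trivial, hence so is `psi`, and every factor will do.
    have h0 : ∀ x y, D.psi x y = 0 := fun x y => by
      have := D.riemann_period z x y
      rw [hp (D.period z x), map_zero, LinearMap.zero_apply] at this
      exact_mod_cast this.symm
    exact ⟨1, one_pos, fun x y => by rw [h0, h0, mul_zero]⟩

/-- An isogeny between two members of the family acts on `V = H₁(·, ℚ)` by an element of `Γ`:
compatibility with `K` and with the polarizations places it in `GU⁺(ℚ)`, and compatibility with
the level structures places it in `𝒦`. -/
theorem exists_mem_Gamma {z z' : D.Domain}
    (φ : (D.variety 𝒦 z).Isogeny (D.variety 𝒦 z')) :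
    ∃ γ ∈ D.Gamma 𝒦, ∀ v : V, γ.1 v = φ.onH1 v := by
  let e : V ≃ₗ[ℚ] V := φ.onH1
  let L : (D.Coord → ℂ) ≃ₗ[ℂ] (D.Coord → ℂ) := φ.onLie
  let g : V ≃ₗ[K] V := { e with map_smul' := fun b x => φ.ι_H1 b x }
  obtain ⟨r, -, hr⟩ := φ.pol
  have hg : g ∈ D.GUPos := exists_pos_factor (z := z) (z' := z') (g := g) (L := L)
    φ.per_comm hr
  refine ⟨⟨g, hg⟩, ?_, fun _ => rfl⟩
  have h1 : (D.variety 𝒦 z').level = _ := φ.level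
  have h2 : toAdelic g ∈ {k | k ∈ 𝒦} := by
    change toAdelic g ∈ (D.variety 𝒦 z').level
    rw [h1]
    exact ⟨(1 : AdelicGL V), 𝒦.one_mem, rfl⟩
  exact h2

/-- An element of `Γ` induces an isogeny from `A_z` to `A_{γ z}`. -/
def isogenyOfGamma (γ : D.GUPos) (hγ : γ ∈ D.Gamma 𝒦)
    (hψ : ∀ x y, D.psi (γ.1 x) (γ.1 y) = D.psi x y) (z : D.Domain) :
    (D.variety 𝒦 z).Isogeny (D.variety 𝒦 (D.act γ z)) where
  onH1 := (γ.1.restrictScalars ℚ : V ≃ₗ[ℚ] V)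
  onLie := (D.blockEquiv (transpose (D.autFactor γ z))).symm
  per_comm x := ((LinearEquiv.eq_symm_apply _).2 (D.blockEquiv_period hψ z x))
  pol := ⟨1, one_ne_zero, fun x y => by
    rw [one_mul]
    exact (hψ x y).symm⟩
  ι_H1 b x := γ.1.map_smul b x
  ι_Lie b p := by
    refine (LinearEquiv.symm_apply_eq _).2 ?_
    have h := D.blockEquiv_diagAct (transpose (D.autFactor γ z)) b
      ((D.blockEquiv (transpose (D.autFactor γ z))).symm p)
    exact (h.trans (congrArg (diagAct D.coordEmb b)
      ((D.blockEquiv (transpose (D.autFactor γ z))).apply_symm_apply p))).symm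
  level := by
    have hγ' : toAdelic γ.1 ∈ 𝒦 := hγ
    ext k
    constructor
    · intro hk
      let k' : AdelicGL V := k
      refine ⟨(toAdelic γ.1)⁻¹ * k', 𝒦.mul_mem (𝒦.inv_mem hγ') hk, ?_⟩
      exact (mul_inv_cancel_left (toAdelic γ.1) k').symm
    · rintro ⟨k', hk', rfl⟩
      exact 𝒦.mul_mem hγ' hk'

/-- An isogeny from `A_z` to `A_{z'}` given by `γ ∈ Γ` exists only for `z' = γ z`, and then it
relates the coordinate frames by the factor of automorphy. -/
theorem relates_frameAt {z z' : D.Domain} (φ : (D.variety 𝒦 z).Isogeny (D.variety 𝒦 z'))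
    {γ : D.GUPos} (hγ : ∀ v : V, γ.1 v = φ.onH1 v)
    (hψ : ∀ x y, D.psi (γ.1 x) (γ.1 y) = D.psi x y) :
    z' = D.act γ z ∧ φ.Relates (D.frameAt 𝒦 z) (D.autFactor γ z)⁻¹ (D.frameAt 𝒦 z') := by
  classical
  let L : (D.Coord → ℂ) ≃ₗ[ℂ] (D.Coord → ℂ) := φ.onLie
  have hL : ∀ b p, L.toLinearMap (diagAct D.coordEmb b p) =
      diagAct D.coordEmb b (L.toLinearMap p) := φ.ι_Lie
  have hper : ∀ v, D.period z' (γ.1 v) = L.toLinearMap (D.period z v) := fun v => by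
    rw [hγ]
    exact φ.per_comm v
  refine ⟨D.eq_act_of_period hL hper, fun τ => ⟨fun ω => ?_, fun ω => ?_⟩⟩
  · have h1 := congrArg Matrix.transpose (D.lam_transpose_mul_block hL hper hψ τ)
    rw [Matrix.transpose_mul, Matrix.transpose_transpose, Matrix.transpose_one] at h1
    have h2 : ((D.autFactor γ z)⁻¹ τ).1.val = (block (D.fstIdx τ) L.toLinearMap)ᵀ := by
      have : (D.autFactor γ z τ).1⁻¹.val = _ :=
        Matrix.coe_units_inv ((D.autFactor γ z τ).1)
      exact this.trans (Matrix.inv_eq_left_inv h1)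
    rw [glEquiv_apply, h2]
    have h3 := dual_apply_single_eq_block hL (D.fstIdx_injective τ) (D.coordEmb_eq_iff τ)
      (ω.1 : (D.Coord → ℂ) →ₗ[ℂ] ℂ)
    exact h3
  · have h1 := congrArg Matrix.transpose (D.mu_transpose_mul_block hL hper hψ τ)
    rw [Matrix.transpose_mul, Matrix.transpose_transpose, Matrix.transpose_one] at h1
    have h2 : ((D.autFactor γ z)⁻¹ τ).2.val = (block (D.sndIdx τ) L.toLinearMap)ᵀ := by
      have : (D.autFactor γ z τ).2⁻¹.val = _ :=
        Matrix.coe_units_inv ((D.autFactor γ z τ).2)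
      exact this.trans (Matrix.inv_eq_left_inv h1)
    rw [glEquiv_apply, h2]
    have h3 := dual_apply_single_eq_block hL (D.sndIdx_injective τ) (D.coordEmb_eq_conj_iff τ)
      (ω.1 : (D.Coord → ℂ) →ₗ[ℂ] ℂ)
    exact h3

/-! ### Functions of pairs and automorphic functions -/

section Functions

variable {X : Type w} [AddCommGroup X] [Module ℂ X] {ρ : Representation ℂ D.H X}

/-- The values of an equivariant function at pairs whose varieties are isogenous determine each
other. -/
theorem IsPairFunction.eq_of_relates {F : D.Pair 𝒦 → X} (hF : D.IsPairFunction 𝒦 ρ F)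
    {P Q : D.Pair 𝒦} {φ : P.1.1.Isogeny Q.1.1} {h : D.H} (hφ : φ.Relates P.2 h Q.2) :
    F Q = ρ h⁻¹ (F P) := by
  -- The frame `(ᵗh)⁻¹ Q.2` is the one whose pull-back along `φ` is `P.2` itself.
  have h1 := hφ.smul (transpose h)⁻¹
  have h2 : transpose ((transpose h)⁻¹ : D.H) = h⁻¹ := by
    have : (transpose h)⁻¹ = (transpose h⁻¹ : D.H) := rfl
    rw [this, transpose_transpose]
  rw [h2, mul_inv_cancel] at h1
  have h3 := hF.equivalent P ⟨Q.1, Q.2.smul (transpose h)⁻¹⟩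
    ⟨φ, (φ.relates_one_iff _ _).1 h1⟩
  have h4 := hF.smul Q.1 Q.2 (transpose h)⁻¹
  rw [h2, inv_inv] at h4
  rw [h3, h4, ← Module.End.mul_apply, ← map_mul, inv_mul_cancel, map_one,
    Module.End.one_apply]
  rfl

theorem IsPairFunction.isAutomorphicFunction {F : D.Pair 𝒦 → X}
    (hF : D.IsPairFunction 𝒦 ρ F)
    (h𝒦 : @IsCompact _ (adelicTopology V) (𝒦 : Set (AdelicGL V))) :
    D.IsAutomorphicFunction 𝒦 ρ fun z => F (D.pairAt 𝒦 z) := by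
  intro γ hγ
  funext z
  have hψ := D.psi_Gamma h𝒦 hγ
  have h := (relates_frameAt (isogenyOfGamma γ hγ hψ z) (γ := γ) (fun _ => rfl) hψ).2
  have h1 : F (D.pairAt 𝒦 (D.act γ z)) = ρ ((D.autFactor γ z)⁻¹)⁻¹ (F (D.pairAt 𝒦 z)) :=
    hF.eq_of_relates (P := D.pairAt 𝒦 z) (Q := D.pairAt 𝒦 (D.act γ z)) h
  rw [slash, h1, ← Module.End.mul_apply, ← map_mul, mul_inv_cancel, map_one,
    Module.End.one_apply]

/-- The graph of the function of pairs that corresponds to a function on `𝓗`. -/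
def IsValueAt (ρ : Representation ℂ D.H X) (f : D.Domain → X) (P : D.Pair 𝒦) (x : X) : Prop :=
  ∃ (z : D.Domain) (φ : (D.variety 𝒦 z).Isogeny P.1.1) (h : D.H),
    φ.Relates (D.frameAt 𝒦 z) h P.2 ∧ x = ρ h⁻¹ (f z)

theorem exists_isValueAt (ρ : Representation ℂ D.H X) (f : D.Domain → X) (P : D.Pair 𝒦) :
    ∃ x, IsValueAt ρ f P x := by
  obtain ⟨z, ⟨φ⟩⟩ := P.1.2
  obtain ⟨h, hφ⟩ := φ.exists_relates (D.frameAt 𝒦 z) P.2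
  exact ⟨_, z, φ, h, hφ, rfl⟩

/-- Two uniformizations of the same pair differ by an element of `Γ`, so the automorphy of `f` makes
the value well defined. -/
theorem IsValueAt.unique {f : D.Domain → X} (hf : D.IsAutomorphicFunction 𝒦 ρ f)
    (h𝒦 : @IsCompact _ (adelicTopology V) (𝒦 : Set (AdelicGL V))) {P : D.Pair 𝒦} {x y : X}
    (hx : IsValueAt ρ f P x) (hy : IsValueAt ρ f P y) : x = y := by
  obtain ⟨z, φ, h, hφ, rfl⟩ := hx
  obtain ⟨z', φ', h', hφ', rfl⟩ := hy
  obtain ⟨γ, hγ, hγφ⟩ := exists_mem_Gamma (φ.trans φ'.symm)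
  obtain ⟨rfl, hrel⟩ := relates_frameAt (φ.trans φ'.symm) hγφ (D.psi_Gamma h𝒦 hγ)
  have h1 : h * h'⁻¹ = (D.autFactor γ z)⁻¹ := (hφ.trans hφ'.symm).unique hrel
  have h2 : h⁻¹ = h'⁻¹ * D.autFactor γ z := by
    rw [← inv_inv (D.autFactor γ z), ← h1]
    group
  have h3 : ρ (D.autFactor γ z)⁻¹ (f (D.act γ z)) = f z := congrFun (hf γ hγ) z
  rw [h2, ← h3, ← Module.End.mul_apply, ← map_mul, mul_inv_cancel_right]

/-- The function of pairs that corresponds to a function on `𝓗`. -/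
def pairFunction (𝒦 : Subgroup (AdelicGL V)) (ρ : Representation ℂ D.H X) (f : D.Domain → X)
    (P : D.Pair 𝒦) : X :=
  (exists_isValueAt ρ f P).choose

theorem isValueAt_pairFunction (ρ : Representation ℂ D.H X) (f : D.Domain → X) (P : D.Pair 𝒦) :
    IsValueAt ρ f P (pairFunction 𝒦 ρ f P) :=
  (exists_isValueAt ρ f P).choose_spec

theorem pairFunction_pairAt {f : D.Domain → X} (hf : D.IsAutomorphicFunction 𝒦 ρ f)
    (h𝒦 : @IsCompact _ (adelicTopology V) (𝒦 : Set (AdelicGL V))) (z : D.Domain) :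
    pairFunction 𝒦 ρ f (D.pairAt 𝒦 z) = f z := by
  refine (isValueAt_pairFunction ρ f _).unique hf h𝒦
    ⟨z, PELVariety.Isogeny.refl _, 1, PELVariety.Isogeny.Relates.refl _, ?_⟩
  rw [inv_one, map_one, Module.End.one_apply]

theorem isPairFunction_pairFunction {f : D.Domain → X} (hf : D.IsAutomorphicFunction 𝒦 ρ f)
    (h𝒦 : @IsCompact _ (adelicTopology V) (𝒦 : Set (AdelicGL V))) :
    D.IsPairFunction 𝒦 ρ (pairFunction 𝒦 ρ f) where
  equivalent P Q := by
    rintro ⟨ψ, hψ⟩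
    obtain ⟨z, φ, h, hφ, hx⟩ := isValueAt_pairFunction ρ f P
    have h1 := hφ.trans ((ψ.relates_one_iff _ _).2 hψ)
    rw [mul_one] at h1
    exact IsValueAt.unique hf h𝒦 (P := Q) ⟨z, _, h, h1, hx⟩ (isValueAt_pairFunction ρ f Q)
  smul A l g := by
    obtain ⟨z, φ, h, hφ, hx⟩ := isValueAt_pairFunction ρ f ⟨A, l⟩
    refine (isValueAt_pairFunction ρ f ⟨A, l.smul g⟩).unique hf h𝒦 ⟨z, φ, _, hφ.smul g, ?_⟩
    rw [hx, ← Module.End.mul_apply, ← map_mul, mul_inv_rev]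

theorem IsPairFunction.eq_pairFunction {F : D.Pair 𝒦 → X} (hF : D.IsPairFunction 𝒦 ρ F) :
    pairFunction 𝒦 ρ (fun z => F (D.pairAt 𝒦 z)) = F := by
  funext P
  obtain ⟨z, φ, h, hφ, hx⟩ :=
    isValueAt_pairFunction ρ (fun z => F (D.pairAt 𝒦 z)) P
  rw [hx]
  exact (hF.eq_of_relates (P := D.pairAt 𝒦 z) (Q := P) hφ).symm

end Functions

end Datum

end Family

end

end UnitaryPEL

theorem mainTheorem3
    {K : Type*} [Field K] [NumberField K] [NumberField.IsCMField K]
    {V : Type*} [AddCommGroup V] [Module K V] [Module ℚ V] [IsScalarTower ℚ K V]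
    [FiniteDimensional ℚ V]
    (D : UnitaryPEL.Datum K V)
    (𝒦 : Subgroup (UnitaryPEL.AdelicGL V))
    (h𝒦 : D.IsOpenCompact 𝒦) (h𝒦neat : UnitaryPEL.IsNeat 𝒦)
    {X : Type*} [AddCommGroup X] [Module ℂ X] [FiniteDimensional ℂ X]
    (ρ : Representation ℂ D.H X) (hρ : D.IsAlgebraicRep ρ) :
    ∃ e : {F : D.Pair 𝒦 → X // D.IsPairFunction 𝒦 ρ F} ≃
        {f : D.Domain → X // D.IsAutomorphicFunction 𝒦 ρ f},
      ∀ (F : {F : D.Pair 𝒦 → X // D.IsPairFunction 𝒦 ρ F}) (z : D.Domain),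
        (e F).1 z = F.1 (D.pairAt 𝒦 z) :=
  ⟨{ toFun := fun F => ⟨fun z => F.1 (D.pairAt 𝒦 z), F.2.isAutomorphicFunction h𝒦.2.1⟩
     invFun := fun f => ⟨UnitaryPEL.Datum.pairFunction 𝒦 ρ f.1,
      UnitaryPEL.Datum.isPairFunction_pairFunction f.2 h𝒦.2.1⟩
     left_inv := fun F => Subtype.ext F.2.eq_pairFunction
     right_inv := fun f => Subtype.ext (funext fun z =>
      UnitaryPEL.Datum.pairFunction_pairAt f.2 h𝒦.2.1 z) },
    fun _ _ => rfl⟩
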